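/- **Theorem (Combes–Thomas estimate).** *Setting.* Let $\Gamma$ be the cubic lattice graph in $\mathbb R^d$ with vertex set $\mathbb Z^d$ and edge set $E(\Gamma)$ consisting of the segments from $v$ to $v+e_j$ ($v\in\mathbb Z^d$, $1\le j\le d$), each identified with $[0,1]$. A bounded domain (nonempty connected open set) $U\subset\mathbb R^d$ is called *$\Gamma$-edge bounded* if every edge $e\in E(\Gamma)$ either is contained in $\partial U$ or meets $\partial U$ at most in its endpoints; $E(\Gamma\cap U)$ denotes the set of edges whose interior lies in $U$. For a $\Gamma$-edge bounded open box (product of bounded open intervals) $\Lambda$ put $L_2(\Gamma\cap\Lambda)=\bigoplus_{e\in E(\Gamma\cap\Lambda)}L_2(0,1)$ (complex valued) and let $W_2^1(\Gamma\cap\Lambda)$ be the space of $f\in\bigoplus_{e\in E(\Gamma\cap\Lambda)}W_2^1(0,1)$ that are continuous at all vertices and satisfy $\sum_e\|f_e\|^2_{W_2^1(0,1)}<\infty$. For $q_-,q_+\in\mathbb R$ and $\omega\in[q_-,q_+]^{E(\Gamma)}$ let $H^N_\Lambda=H^N_\Lambda(\omega)$ be the operator in $L_2(\Gamma\cap\Lambda)$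 associated with the form $$\mathfrak h(f,g)=\sum_{e\in E(\Gamma\cap\Lambda)}\big[(f_e'\,|\,g_e')_{L_2(0,1)}+\omega_e\,(f_e\,|\,g_e)_{L_2(0,1)}\big],\qquad D(\mathfrak h)=W_2^1(\Gamma\cap\Lambda),$$ and $\varrho(H^N_\Lambda)$ its resolvent set. For a $\Gamma$-edge bounded $A\subset\Lambda$, $\chi_A$ is multiplication by the characteristic function of $A$, i.e. it keeps the components $f_e$ with $e\in E(\Gamma\cap A)$ and replaces the others by $0$. *Claim.* Let $q_-,q_+\in\mathbb R$ and $R>0$. There exist constants $c_1,c_2>0$ depending only on $q_-,q_+,R$ such that for every dimension $d$ and every $\omega\in[q_-,q_+]^{E(\Gamma)}$ the following holds. If (i) $\Lambda\subset\mathbb R^d$ is a $\Gamma$-edge bounded open box, $A,B\subset\Lambda$ are $\Gamma$-edge bounded, and $\delta:=\operatorname{dist}(A,B)\ge1$ (Euclidean distance); (ii) $r,s,E\in\mathbb R$ satisfy $(r,s)\subset\varrho(H^N_\Lambda)\cap(-R,R)$, $E\in(r,s)$, and $\eta:=\operatorname{dist}(E,(r,s)^c)$; then, in operator norm on $L_2(\Gamma\cap\Lambda)$,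 $$\|\chi_A(H^N_\Lambda-E)^{-1}\chi_B\|\le c_1\,\eta^{-1}\,e^{-c_2\sqrt{\eta(s-r)}\,\delta}.$$ -/

import Mathlib

open MeasureTheory Set
open scoped ENNReal InnerProductSpace

noncomputable section

namespace QuantumGraph

/-! ### The cubic lattice graph and its embedding -/

/-- An edge of the cubic lattice graph `Γ` with vertex set `ℤ^d`: the segment of length one from
the vertex `base` to the vertex `base + e_dir`. -/
structure Edge (d : ℕ) where
  base : Fin d → ℤ
  dir : Fin d

/-- The initial vertex `ι(e)`. -/
def Edge.init {d : ℕ} (e : Edge d) : Fin d → ℤ := e.base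

/-- The terminal vertex `τ(e)`. -/
def Edge.term {d : ℕ} (e : Edge d) : Fin d → ℤ := e.base + Pi.single e.dir 1

/-- The point of `ℝ^d` with parameter `t ∈ [0,1]` on the edge `e`. -/
def Edge.point {d : ℕ} (e : Edge d) (t : ℝ) : EuclideanSpace ℝ (Fin d) :=
  WithLp.toLp 2 (fun i => (e.base i : ℝ) + if i = e.dir then t else 0)

/-- A `Γ`-edge bounded domain: a bounded domain (nonempty connected open set) such that each
(closed) edge is contained in the boundary or meets the boundary at most in its endpoints. -/
structure IsEdgeBounded {d : ℕ} (U : Set (EuclideanSpace ℝ (Fin d))) : Prop where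
  isOpen : IsOpen U
  isConnected : IsConnected U
  isBounded : Bornology.IsBounded U
  edge : ∀ e : Edge d,
    e.point '' Icc 0 1 ⊆ frontier U ∨
      e.point '' Icc 0 1 ∩ frontier U ⊆ {e.point 0, e.point 1}

/-- An open box in `ℝ^d`: a product of bounded open intervals. -/
def IsBox {d : ℕ} (U : Set (EuclideanSpace ℝ (Fin d))) : Prop :=
  ∃ a b : Fin d → ℝ, U = {x | ∀ i, x i ∈ Ioo (a i) (b i)}

/-- The edge set `E(Γ ∩ U)`: the edges whose interior lies in the open set `U`
(edges outside `U` and edges on the boundary are deleted). -/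
def edgesIn {d : ℕ} (U : Set (EuclideanSpace ℝ (Fin d))) : Set (Edge d) :=
  {e | e.point '' Ioo 0 1 ⊆ U}

/-- The Euclidean distance `inf {|x - y| : x ∈ A, y ∈ B}` of two (nonempty) sets. -/
def setDist {d : ℕ} (A B : Set (EuclideanSpace ℝ (Fin d))) : ℝ :=
  sInf (image2 dist A B)

/-! ### Function spaces -/

/-- The Hilbert space `L_2(0,1)` (complex valued). -/
abbrev EdgeL2 : Type := Lp ℂ 2 (volume.restrict (Ioo (0 : ℝ) 1))

/-- `F` is an absolutely continuous representative of `f ∈ L_2(0,1)` on `[0,1]`, with derivative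
`g ∈ L_2(0,1)`. The Sobolev space `W_2^1(0,1)` consists of the `f` for which such `g`, `F` exist;
then `f' = g`, and `F 0`, `F 1` are the boundary values of `f`. -/
def HasSobolevRep (f g : EdgeL2) (F : ℝ → ℂ) : Prop :=
  (f =ᵐ[volume.restrict (Ioo (0 : ℝ) 1)] F) ∧
    ∀ x ∈ Icc (0 : ℝ) 1, F x = F 0 + ∫ t in (0 : ℝ)..x, g t

/-- The Hilbert sum `⨁_{e ∈ S} L_2(0,1)` over a set of edges; `L_2(Γ ∩ Λ)` is
`GraphL2 (edgesIn Λ)`. -/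
abbrev GraphL2 {d : ℕ} (S : Set (Edge d)) : Type := lp (fun _ : S => EdgeL2) 2

/-- `f` belongs to `W_2^1` of the graph with edge set `S` and has derivative `f'`: every edge
component lies in `W_2^1(0,1)`, the derivatives are square summable (`f'` is an element of the
Hilbert sum), and `f` is continuous at all vertices: the boundary values at the ends of the edges
are given by a function `φ` on the vertices. -/
def HasGraphDeriv {d : ℕ} {S : Set (Edge d)} (f f' : GraphL2 S) : Prop :=
  ∃ (F : S → ℝ → ℂ) (φ : (Fin d → ℤ) → ℂ), ∀ e : S,
    HasSobolevRep (f e) (f' e) (F e) ∧ F e 0 = φ e.1.init ∧ F e 1 = φ e.1.term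

lemma edgeL2_intervalIntegrable (g : EdgeL2) {x : ℝ} (hx : x ∈ Icc (0 : ℝ) 1) :
    IntervalIntegrable g volume 0 x := by
  have h1 : Integrable g (volume.restrict (Ioo (0 : ℝ) 1)) :=
    (Lp.memLp g).integrable (by norm_num)
  have h2 : IntegrableOn g (Ioc (0 : ℝ) 1) volume := by
    rw [integrableOn_Ioc_iff_integrableOn_Ioo]; exact h1
  rw [intervalIntegrable_iff_integrableOn_Ioc_of_le hx.1]
  exact h2.mono_set (Ioc_subset_Ioc_right hx.2)

lemma edgeL2_ae_interval {f g : ℝ → ℂ} (h : f =ᵐ[volume.restrict (Ioo (0 : ℝ) 1)] g)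
    {x : ℝ} (hx : x ∈ Icc (0 : ℝ) 1) :
    ∫ t in (0 : ℝ)..x, f t = ∫ t in (0 : ℝ)..x, g t := by
  rw [intervalIntegral.integral_of_le hx.1, intervalIntegral.integral_of_le hx.1,
    integral_Ioc_eq_integral_Ioo, integral_Ioc_eq_integral_Ioo]
  exact integral_congr_ae (ae_restrict_of_ae_restrict_of_subset (Ioo_subset_Ioo_right hx.2) h)

lemma HasSobolevRep.add {f g f₂ g₂ : EdgeL2} {F F₂ : ℝ → ℂ} (h : HasSobolevRep f g F)
    (h₂ : HasSobolevRep f₂ g₂ F₂) : HasSobolevRep (f + f₂) (g + g₂) (F + F₂) := by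
  refine ⟨?_, fun x hx => ?_⟩
  · exact (Lp.coeFn_add f f₂).trans (h.1.add h₂.1)
  · rw [edgeL2_ae_interval (Lp.coeFn_add g g₂) hx]
    simp only [Pi.add_apply]
    rw [intervalIntegral.integral_add (edgeL2_intervalIntegrable g hx)
      (edgeL2_intervalIntegrable g₂ hx), h.2 x hx, h₂.2 x hx]
    ring

lemma HasSobolevRep.smul {f g : EdgeL2} {F : ℝ → ℂ} (c : ℂ) (h : HasSobolevRep f g F) :
    HasSobolevRep (c • f) (c • g) (c • F) := by
  refine ⟨?_, fun x hx => ?_⟩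
  · exact (Lp.coeFn_smul c f).trans (h.1.const_smul c)
  · rw [edgeL2_ae_interval (Lp.coeFn_smul c g) hx]
    simp only [Pi.smul_apply]
    rw [intervalIntegral.integral_smul, h.2 x hx, smul_add]

lemma HasSobolevRep.zero : HasSobolevRep 0 0 0 := by
  refine ⟨Lp.coeFn_zero _ _ _, fun x hx => ?_⟩
  rw [edgeL2_ae_interval (Lp.coeFn_zero ℂ 2 _) hx]
  simp

lemma HasSobolevRep.deriv_eq_zero {g : EdgeL2} {F : ℝ → ℂ} (h : HasSobolevRep 0 g F) : g = 0 := by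
  have hF : F =ᵐ[volume.restrict (Ioo (0 : ℝ) 1)] (0 : ℝ → ℂ) :=
    h.1.symm.trans (Lp.coeFn_zero _ _ _)
  have hg1 := edgeL2_intervalIntegrable g (x := 1) (by simp)
  have hcont : ContinuousOn F (Ioo 0 1) := by
    have h1 : ContinuousOn (fun x => F 0 + ∫ t in (0 : ℝ)..x, g t) (uIcc 0 1) :=
      continuousOn_const.add
        (intervalIntegral.continuousOn_primitive_interval' hg1 (by simp))
    rw [uIcc_of_le zero_le_one] at h1
    exact (h1.congr fun x hx => h.2 x hx).mono Ioo_subset_Icc_self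
  have hF0 : EqOn F 0 (Ioo 0 1) :=
    Measure.eqOn_open_of_ae_eq hF isOpen_Ioo hcont continuousOn_const
  apply Lp.ext
  refine Filter.EventuallyEq.trans ?_ (Lp.coeFn_zero _ _ _).symm
  have hd := hg1.ae_hasDerivAt_integral
  rw [Filter.EventuallyEq, ae_restrict_iff' measurableSet_Ioo]
  filter_upwards [hd] with x hx hx01
  have h3 : HasDerivAt (fun y => ∫ t in (0 : ℝ)..y, g t) (g x) x :=
    hx (by rw [uIcc_of_le zero_le_one]; exact Ioo_subset_Icc_self hx01) 0 (by simp)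
  have h4 : (fun y => ∫ t in (0 : ℝ)..y, g t) =ᶠ[nhds x] fun _ => - F 0 := by
    filter_upwards [isOpen_Ioo.mem_nhds hx01] with y hy
    have := h.2 y (Ioo_subset_Icc_self hy)
    rw [hF0 hy] at this
    simp only [Pi.zero_apply] at this
    linear_combination -this
  exact h3.unique ((hasDerivAt_const x (-F 0)).congr_of_eventuallyEq h4)

lemma HasGraphDeriv.add {d : ℕ} {S : Set (Edge d)} {f f' g g' : GraphL2 S}
    (hf : HasGraphDeriv f f') (hg : HasGraphDeriv g g') : HasGraphDeriv (f + g) (f' + g') := by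
  obtain ⟨F, φ, h⟩ := hf
  obtain ⟨G, ψ, k⟩ := hg
  refine ⟨F + G, φ + ψ, fun e => ⟨(h e).1.add (k e).1, ?_, ?_⟩⟩
  · simp [(h e).2.1, (k e).2.1]
  · simp [(h e).2.2, (k e).2.2]

lemma HasGraphDeriv.smul {d : ℕ} {S : Set (Edge d)} {f f' : GraphL2 S} (c : ℂ)
    (hf : HasGraphDeriv f f') : HasGraphDeriv (c • f) (c • f') := by
  obtain ⟨F, φ, h⟩ := hf
  refine ⟨c • F, c • φ, fun e => ⟨(h e).1.smul c, ?_, ?_⟩⟩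
  · simp [(h e).2.1]
  · simp [(h e).2.2]

lemma HasGraphDeriv.unique {d : ℕ} {S : Set (Edge d)} {f f' f'' : GraphL2 S}
    (h : HasGraphDeriv f f') (k : HasGraphDeriv f f'') : f' = f'' := by
  obtain ⟨F, φ, hF⟩ := h.add (k.smul (-1))
  refine lp.ext (funext fun e => ?_)
  have h1 := (hF e).1
  have h2 : ((f + (-1 : ℂ) • f : GraphL2 S) : ∀ _ : S, EdgeL2) e = 0 := by simp
  rw [h2] at h1
  have h3 := h1.deriv_eq_zero
  simpa [add_neg_eq_zero] using h3

/-- The Sobolev space `W_2^1` of the graph with edge set `S`. -/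
def W12 {d : ℕ} (S : Set (Edge d)) : Submodule ℂ (GraphL2 S) where
  carrier := {f | ∃ f', HasGraphDeriv f f'}
  add_mem' := fun ⟨f', hf⟩ ⟨g', hg⟩ => ⟨f' + g', hf.add hg⟩
  zero_mem' := ⟨0, 0, 0, fun _ => ⟨HasSobolevRep.zero, rfl, rfl⟩⟩
  smul_mem' := fun c _ ⟨f', hf⟩ => ⟨c • f', hf.smul c⟩

/-- The derivative of an element of `W_2^1`. -/
def graphDeriv {d : ℕ} {S : Set (Edge d)} : W12 S →ₗ[ℂ] GraphL2 S where
  toFun f := f.2.choose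
  map_add' f g := (f + g).2.choose_spec.unique (f.2.choose_spec.add g.2.choose_spec)
  map_smul' c f := (c • f).2.choose_spec.unique (f.2.choose_spec.smul c)

lemma hasGraphDeriv_graphDeriv {d : ℕ} {S : Set (Edge d)} (f : W12 S) :
    HasGraphDeriv (f : GraphL2 S) (graphDeriv f) :=
  f.2.choose_spec

/-! ### The Schrödinger operator with Neumann boundary conditions -/

/-- The configuration space `Ω = [q₋, q₊]^E` of coupling constants. -/
abbrev Config (d : ℕ) (qm qp : ℝ) : Type := Edge d → Icc qm qp

/-- The sesquilinear form `∑_e [(u_e' | v_e') + (ω_e u_e | v_e)]` with domain `W_2^1`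
(antilinear in the first argument). -/
def form {d : ℕ} {qm qp : ℝ} (ω : Config d qm qp) (S : Set (Edge d)) (u v : W12 S) : ℂ :=
  ∑' e : S, (⟪graphDeriv u e, graphDeriv v e⟫_ℂ +
    ((ω e : ℝ) : ℂ) * ⟪(u : GraphL2 S) e, (v : GraphL2 S) e⟫_ℂ)

lemma form_summable {d : ℕ} {qm qp : ℝ} (ω : Config d qm qp) (S : Set (Edge d)) (u v : W12 S) :
    Summable fun e : S => (⟪graphDeriv u e, graphDeriv v e⟫_ℂ +
      ((ω e : ℝ) : ℂ) * ⟪(u : GraphL2 S) e, (v : GraphL2 S) e⟫_ℂ) := by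
  refine (lp.summable_inner (graphDeriv u) (graphDeriv v)).add ?_
  have h := (lp.summable_inner (𝕜 := ℂ) (u : GraphL2 S) (v : GraphL2 S)).norm
  refine Summable.of_norm_bounded (h.mul_left (max |qm| |qp|)) fun e => ?_
  rw [norm_mul, Complex.norm_real, Real.norm_eq_abs]
  gcongr
  exact abs_le_max_abs_abs (ω e).2.1 (ω e).2.2

lemma form_add_right {d : ℕ} {qm qp : ℝ} (ω : Config d qm qp) (S : Set (Edge d))
    (u v w : W12 S) : form ω S u (v + w) = form ω S u v + form ω S u w := by
  rw [form, form, form, ← (form_summable ω S u v).tsum_add (form_summable ω S u w)]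
  refine tsum_congr fun e => ?_
  simp only [map_add, Submodule.coe_add, lp.coeFn_add, Pi.add_apply, inner_add_right]
  ring

lemma form_smul_right {d : ℕ} {qm qp : ℝ} (ω : Config d qm qp) (S : Set (Edge d))
    (u v : W12 S) (c : ℂ) : form ω S u (c • v) = c * form ω S u v := by
  rw [form, form, ← tsum_mul_left]
  refine tsum_congr fun e => ?_
  simp only [map_smul, Submodule.coe_smul, lp.coeFn_smul, Pi.smul_apply, inner_smul_right]
  ring

/-- The graph of the operator associated with the form: `u ∈ D(H)` and `H u = f` if and only if
`u ∈ W_2^1` and `h(v, u) = (v | f)` for all `v ∈ W_2^1`. -/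
def hamiltonianGraph {d : ℕ} {qm qp : ℝ} (ω : Config d qm qp) (S : Set (Edge d)) :
    Submodule ℂ (GraphL2 S × GraphL2 S) where
  carrier := {p | ∃ u : W12 S, (u : GraphL2 S) = p.1 ∧
    ∀ v : W12 S, form ω S v u = ⟪(v : GraphL2 S), p.2⟫_ℂ}
  add_mem' := by
    rintro p q ⟨u, hu, h⟩ ⟨w, hw, k⟩
    refine ⟨u + w, by simp [hu, hw], fun v => ?_⟩
    rw [form_add_right, h, k, Prod.snd_add, inner_add_right]
  zero_mem' := by
    refine ⟨0, rfl, fun v => ?_⟩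
    have := form_smul_right ω S v 0 0
    simpa using this
  smul_mem' := by
    rintro c p ⟨u, hu, h⟩
    refine ⟨c • u, by simp [hu], fun v => ?_⟩
    rw [form_smul_right, h, Prod.smul_snd, inner_smul_right]

/-- A smooth function with compact support in the open interval of one edge, extended by zero to
the other edges, belongs to `W_2^1` (a density fact: the operator below is well defined). -/
lemma exists_test {d : ℕ} {S : Set (Edge d)} (e : S) (g : ℝ → ℝ) (hg : ContDiff ℝ 1 g)
    (hc : HasCompactSupport g) (hs : tsupport g ⊆ Ioo (0 : ℝ) 1) :
    ∃ (v : W12 S) (p : EdgeL2), (p =ᵐ[volume.restrict (Ioo (0 : ℝ) 1)] fun x => (g x : ℂ)) ∧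
      ∀ f : GraphL2 S, ⟪(v : GraphL2 S), f⟫_ℂ = ⟪p, f e⟫_ℂ := by
  classical
  have hgd : ∀ x, HasDerivAt (fun x => (g x : ℂ)) ((deriv g x : ℝ) : ℂ) x := fun x =>
    (hg.differentiable one_ne_zero x).hasDerivAt.ofReal_comp
  have hdc : Continuous (deriv g) := hg.continuous_deriv le_rfl
  have hc1 : HasCompactSupport fun x => (g x : ℂ) := hc.comp_left Complex.ofReal_zero
  have hc2 : HasCompactSupport fun x => ((deriv g x : ℝ) : ℂ) :=
    hc.deriv.comp_left Complex.ofReal_zero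
  have m1 : MemLp (fun x => (g x : ℂ)) 2 (volume.restrict (Ioo (0 : ℝ) 1)) :=
    (Complex.continuous_ofReal.comp hg.continuous).memLp_of_hasCompactSupport hc1
  have m2 : MemLp (fun x => ((deriv g x : ℝ) : ℂ)) 2 (volume.restrict (Ioo (0 : ℝ) 1)) :=
    (Complex.continuous_ofReal.comp hdc).memLp_of_hasCompactSupport hc2
  have g0 : g 0 = 0 := by
    by_contra h
    exact lt_irrefl _ (hs (subset_tsupport g h)).1
  have g1 : g 1 = 0 := by
    by_contra h
    exact lt_irrefl _ (hs (subset_tsupport g h)).2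
  have key : HasSobolevRep m1.toLp m2.toLp (fun x => (g x : ℂ)) := by
    refine ⟨m1.coeFn_toLp, fun x hx => ?_⟩
    rw [edgeL2_ae_interval m2.coeFn_toLp hx,
      intervalIntegral.integral_eq_sub_of_hasDerivAt (fun y _ => hgd y)
        ((Complex.continuous_ofReal.comp hdc).intervalIntegrable _ _)]
    ring
  refine ⟨⟨lp.single 2 e m1.toLp, lp.single 2 e m2.toLp,
    fun e' => if e' = e then (fun x => (g x : ℂ)) else 0, 0, fun e' => ?_⟩, m1.toLp,
    m1.coeFn_toLp, fun f => lp.inner_single_left e _ f⟩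
  by_cases he : e' = e
  · subst he
    simpa [g0, g1] using key
  · simpa [he, lp.single_apply_ne] using HasSobolevRep.zero

/-- The operator graph is single valued. -/
theorem hamiltonianGraph_single_valued {d : ℕ} {qm qp : ℝ} (ω : Config d qm qp)
    (S : Set (Edge d)) (p : GraphL2 S × GraphL2 S) (hp : p ∈ hamiltonianGraph ω S)
    (h0 : p.1 = 0) : p.2 = 0 := by
  obtain ⟨u, hu, h⟩ := hp
  have hu0 : u = 0 := Subtype.ext (hu.trans h0)
  have hz : ∀ v : W12 S, ⟪(v : GraphL2 S), p.2⟫_ℂ = 0 := fun v => by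
    rw [← h v, hu0]
    simpa using form_smul_right ω S v 0 0
  refine lp.ext (funext fun e => Lp.ext (Filter.EventuallyEq.trans ?_ (Lp.coeFn_zero _ _ _).symm))
  have hint : IntegrableOn (p.2 e : ℝ → ℂ) (Ioo (0 : ℝ) 1) volume :=
    (Lp.memLp (p.2 e)).integrable (by norm_num)
  rw [Filter.EventuallyEq, ae_restrict_iff' measurableSet_Ioo]
  refine isOpen_Ioo.ae_eq_zero_of_integral_contDiff_smul_eq_zero hint.locallyIntegrableOn
    fun g hg hc hs => ?_
  obtain ⟨v, q, hq, hv⟩ := exists_test e g (hg.of_le (by norm_cast)) hc hs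
  have h1 := hz v
  rw [hv, L2.inner_def] at h1
  rw [← setIntegral_eq_integral_of_forall_compl_eq_zero (s := Ioo (0 : ℝ) 1), ← h1]
  · refine integral_congr_ae ?_
    filter_upwards [hq] with x hx
    simp [hx, mul_comm]
  · intro x hx
    have : g x = 0 := by
      by_contra h
      exact hx (hs (subset_tsupport g h))
    simp [this]

/-- The Schrödinger operator `H^N(ω)` on the graph with edge set `S`, as an unbounded operator in
`⨁_{e ∈ S} L_2(0,1)`; for `S = E(Γ ∩ Λ)` it is `H^N_Λ(ω)`. -/
def hamiltonian {d : ℕ} {qm qp : ℝ} (ω : Config d qm qp) (S : Set (Edge d)) :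
    GraphL2 S →ₗ.[ℂ] GraphL2 S :=
  (hamiltonianGraph ω S).toLinearPMap

/-- The graph of `H^N(ω)` is the one prescribed by the form. -/
theorem hamiltonian_graph {d : ℕ} {qm qp : ℝ} (ω : Config d qm qp) (S : Set (Edge d)) :
    (hamiltonian ω S).graph = hamiltonianGraph ω S :=
  Submodule.toLinearPMap_graph_eq _ (hamiltonianGraph_single_valued ω S)

open Classical in
/-- The operator of multiplication by the characteristic function of a set of edges `S'`. For a
`Γ`-edge bounded `A` each edge lies, up to endpoints, in `A` or outside `A`, so that the
multiplication by the characteristic function `χ_A` is `cutoff (edgesIn A)`. -/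
def cutoff {d : ℕ} {S : Set (Edge d)} (S' : Set (Edge d)) : GraphL2 S →L[ℂ] GraphL2 S :=
  LinearMap.mkContinuous
    { toFun := fun f => (⟨fun e => if (e : Edge d) ∈ S' then f e else 0,
        (lp.memℓp f).mono' fun e => by split_ifs <;> simp⟩ : GraphL2 S)
      map_add' := fun f g => lp.ext (funext fun e => by
        change (if (e : Edge d) ∈ S' then (f + g) e else 0) =
          (if (e : Edge d) ∈ S' then f e else 0) + (if (e : Edge d) ∈ S' then g e else 0)
        split_ifs <;> simp)
      map_smul' := fun c f => lp.ext (funext fun e => by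
        change (if (e : Edge d) ∈ S' then (c • f) e else 0) =
          c • (if (e : Edge d) ∈ S' then f e else 0)
        split_ifs <;> simp) } 1 (fun f => by
      rw [one_mul]
      refine lp.norm_mono two_ne_zero fun e => ?_
      change ‖if (e : Edge d) ∈ S' then f e else 0‖ ≤ ‖f e‖
      split_ifs <;> simp)

/-! ### Resolvents of unbounded operators -/

/-- `B = (T - z)^{-1}`: the bounded, everywhere defined operator `B` is a two-sided inverse of
`T - z : D(T) → X`. -/
def IsResolvent {X : Type*} [NormedAddCommGroup X] [NormedSpace ℂ X] (T : X →ₗ.[ℂ] X) (z : ℂ)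
    (B : X →L[ℂ] X) : Prop :=
  (∀ u : T.domain, B (T u - z • (u : X)) = u) ∧
    ∀ f : X, ∃ u : T.domain, (u : X) = B f ∧ T u - z • (u : X) = f

/-- The inverse is unique, so that the resolvent is well defined. -/
theorem IsResolvent.unique {X : Type*} [NormedAddCommGroup X] [NormedSpace ℂ X] {T : X →ₗ.[ℂ] X}
    {z : ℂ} {B B' : X →L[ℂ] X} (h : IsResolvent T z B) (h' : IsResolvent T z B') : B = B' := by
  ext f
  obtain ⟨u, hu, hf⟩ := h.2 f
  rw [← hu, ← hf, h'.1 u]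

/-- The resolvent set `ρ(T)`. -/
def resolventSet {X : Type*} [NormedAddCommGroup X] [NormedSpace ℂ X] (T : X →ₗ.[ℂ] X) : Set ℂ :=
  {z | ∃ B : X →L[ℂ] X, IsResolvent T z B}

open Classical in
/-- The resolvent `(T - z)^{-1}` for `z ∈ ρ(T)` (and `0` for all other `z`). -/
def resolvent {X : Type*} [NormedAddCommGroup X] [NormedSpace ℂ X] (T : X →ₗ.[ℂ] X) (z : ℂ) :
    X →L[ℂ] X :=
  if h : ∃ B : X →L[ℂ] X, IsResolvent T z B then h.choose else 0

end QuantumGraph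

end

/-!
Write `H` for the Schrödinger operator on the graph with edge set `S`. The proof is the
Combes–Thomas argument: conjugate `H` by a multiplier `exp (ε w)` with `w = 0` on the edges of `B`
and `w = δ` on the edges of `A`, and show that the conjugated operator still has an inverse of norm
`O(η⁻¹)` at `E` for `ε` of the order `√(η (s - r))`.

The weight `w` interpolates on each edge between the values `min (dist (v, B)) δ` at the vertices,
by a cubic whose derivative vanishes at both ends. Hence multiplication by `exp (ε w)` preserves
not only `W_2^1` but also the Kirchhoff conditions, i.e. the domain of `H`
(`graphMul_mem_hamiltonianGraph`), and for `(H - E) g = χ_B f =: h` the function `u = exp (ε w) g`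
satisfies `(H - E) u = h - ε (2 w' u' + w'' u) + ε² w'² u` (`VertexWeight.conjugated_equation`).
The first-order term is skew-symmetric (`VertexWeight.re_inner_first_order`), and `‖u'‖` is
controlled by the form (`norm_deriv_sq_le`).

The gap enters only through the inequality `(H - r) (H - s) ≥ 0` (`gap_inequality`). It says that
`‖(H - m) u‖ ≥ (s - r) / 2 ‖u‖` at the midpoint `m` of the gap, and it follows from the fact that
the norm of the self-adjoint bounded operator `(H - m)⁻¹` is its spectral radius; no spectral
theorem for unbounded operators is needed. Applied to `u`, it bounds `‖(H - E) u‖²` below by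
`(E - r) (s - E) ‖u‖² ≥ η (s - r) ‖u‖² / 2`, up to a multiple of `Re (u | (H - E) u)`. The
skew-symmetric term of order `ε` does not contribute to that real part, and it contributes at most
a small multiple of `√(η (s - r)) ‖u‖` to `‖(H - E) u‖`. So `‖h‖` cannot be much smaller than
`η ‖u‖` (`norm_le_of_gap_inequality`). Restricting `u` to `A`, where `exp (ε w) = exp (ε δ)`, gives
the estimate. The constants do not depend on the dimension because each edge sees only the
difference of the weight at its two endpoints, which is at most one.
-/

noncomputable section

namespace QuantumGraph

/-! ### Absolutely continuous functions on an edge -/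

lemma absolutelyContinuousOnInterval_const {F : Type*} [NormedAddCommGroup F] [NormedSpace ℝ F]
    (c : F) (a b : ℝ) : AbsolutelyContinuousOnInterval (fun _ : ℝ => c) a b :=
  contDiffOn_const.absolutelyContinuousOnInterval

lemma absolutelyContinuousOnInterval_congr {X : Type*} [PseudoMetricSpace X] {f g : ℝ → X}
    {a b : ℝ} (hf : AbsolutelyContinuousOnInterval f a b) (h : EqOn f g (uIcc a b)) :
    AbsolutelyContinuousOnInterval g a b := by
  refine Filter.Tendsto.congr' ?_ hf
  refine Filter.eventually_inf_principal.2 (Filter.Eventually.of_forall fun E hE => ?_)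
  refine Finset.sum_congr rfl fun i hi => ?_
  rw [h (hE.1 i hi).1, h (hE.1 i hi).2]

lemma absolutelyContinuousOnInterval_complex_integral {f : ℝ → ℂ} {a b c : ℝ}
    (h : IntervalIntegrable f volume a b) (hc : c ∈ uIcc a b) :
    AbsolutelyContinuousOnInterval (fun x => ∫ t in c..x, f t) a b := by
  have hre : IntervalIntegrable (fun x => (f x).re) volume a b := ⟨h.1.re, h.2.re⟩
  have him : IntervalIntegrable (fun x => (f x).im) volume a b := ⟨h.1.im, h.2.im⟩
  refine absolutelyContinuousOnInterval_congr
    (((hre.absolutelyContinuousOnInterval_intervalIntegral hc).smul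
      (absolutelyContinuousOnInterval_const (1 : ℂ) a b)).add
    ((him.absolutelyContinuousOnInterval_intervalIntegral hc).smul
      (absolutelyContinuousOnInterval_const Complex.I a b))) fun x hx => ?_
  have hcx : IntervalIntegrable f volume c x := h.mono_set (uIcc_subset_uIcc hc hx)
  have e1 := Complex.reCLM.intervalIntegral_comp_comm hcx
  have e2 := Complex.imCLM.intervalIntegral_comp_comm hcx
  simp only [Complex.reCLM_apply, Complex.imCLM_apply] at e1 e2
  apply Complex.ext <;> simp [e1, e2]

/-- The product rule for two primitives of integrable functions, in integrated form. -/
lemma primitive_mul_primitive {f g F G : ℝ → ℂ} (hf : IntervalIntegrable f volume 0 1)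
    (hg : IntervalIntegrable g volume 0 1)
    (hF : ∀ x ∈ Icc (0 : ℝ) 1, F x = F 0 + ∫ t in (0 : ℝ)..x, f t)
    (hG : ∀ x ∈ Icc (0 : ℝ) 1, G x = G 0 + ∫ t in (0 : ℝ)..x, g t) :
    ∀ x ∈ Icc (0 : ℝ) 1, F x * G x = F 0 * G 0 + ∫ t in (0 : ℝ)..x, (f t * G t + F t * g t) := by
  have h01 : uIcc (0 : ℝ) 1 = Icc 0 1 := uIcc_of_le zero_le_one
  have h0 : (0 : ℝ) ∈ uIcc (0 : ℝ) 1 := by simp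
  -- The primitives, extended beyond `[0,1]` so that they can be differentiated there.
  set F₁ : ℝ → ℂ := fun x => F 0 + ∫ t in (0 : ℝ)..x, f t with hF₁
  set G₁ : ℝ → ℂ := fun x => G 0 + ∫ t in (0 : ℝ)..x, g t with hG₁
  have aF : AbsolutelyContinuousOnInterval F₁ 0 1 :=
    (absolutelyContinuousOnInterval_const (F 0) 0 1).add
      (absolutelyContinuousOnInterval_complex_integral hf h0)
  have aG : AbsolutelyContinuousOnInterval G₁ 0 1 :=
    (absolutelyContinuousOnInterval_const (G 0) 0 1).add
      (absolutelyContinuousOnInterval_complex_integral hg h0)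
  have hi : IntervalIntegrable (fun t => f t * G₁ t + F₁ t * g t) volume 0 1 :=
    (hf.mul_continuousOn aG.continuousOn).add (hg.continuousOn_mul aF.continuousOn)
  have aK := (aF.smul aG).sub (absolutelyContinuousOnInterval_complex_integral hi h0)
  obtain ⟨C, hC⟩ := aK.const_of_ae_hasDerivAt_zero (by
    filter_upwards [hf.ae_hasDerivAt_integral, hg.ae_hasDerivAt_integral,
      hi.ae_hasDerivAt_integral] with x h1 h2 h3 hx
    have := (((h1 hx 0 h0).const_add (F 0)).mul ((h2 hx 0 h0).const_add (G 0))).sub (h3 hx 0 h0)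
    simpa [hF₁, hG₁] using! this)
  intro x hx
  have e0 := hC 0 h0
  have ex := hC x (h01 ▸ hx)
  have eq : ∫ t in (0 : ℝ)..x, (f t * G t + F t * g t) =
      ∫ t in (0 : ℝ)..x, (f t * G₁ t + F₁ t * g t) := by
    refine intervalIntegral.integral_congr fun t ht => ?_
    rw [uIcc_of_le hx.1] at ht
    have ht' : t ∈ Icc (0 : ℝ) 1 := ⟨ht.1, ht.2.trans hx.2⟩
    simp only [hF t ht', hG t ht', hF₁, hG₁]
  rw [eq, hF x hx, hG x hx]
  change F₁ x * G₁ x = _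
  simp only [Pi.sub_apply, smul_eq_mul, Pi.mul_apply] at e0 ex
  have z0 : F₁ 0 * G₁ 0 = F 0 * G 0 := by simp [hF₁, hG₁]
  rw [z0] at e0
  simp only [intervalIntegral.integral_same, sub_zero] at e0
  linear_combination ex - e0

/-! ### Multiplication operators on an edge -/

lemma memLp_mul_continuous (m : C(ℝ, ℝ)) (f : EdgeL2) :
    MemLp (fun t => (m t : ℂ) * f t) 2 (volume.restrict (Ioo (0 : ℝ) 1)) := by
  obtain ⟨C, hC⟩ := (isCompact_Icc (a := (0 : ℝ)) (b := 1)).exists_bound_of_continuousOn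
    m.continuous.continuousOn
  refine (Lp.memLp f).of_le_mul (c := C)
    ((Complex.continuous_ofReal.comp m.continuous).aestronglyMeasurable.mul
      (Lp.aestronglyMeasurable f)) ?_
  filter_upwards [ae_restrict_mem measurableSet_Ioo] with t ht
  rw [norm_mul, Complex.norm_real]
  gcongr
  exact hC t (Ioo_subset_Icc_self ht)

/-- Multiplication by a continuous real function on `L_2(0,1)`. -/
def edgeMul (m : C(ℝ, ℝ)) : EdgeL2 →ₗ[ℂ] EdgeL2 where
  toFun f := (memLp_mul_continuous m f).toLp
  map_add' f g := by
    rw [← MemLp.toLp_add]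
    refine MemLp.toLp_congr _ _ ?_
    filter_upwards [Lp.coeFn_add f g] with t ht
    rw [ht, Pi.add_apply, Pi.add_apply, mul_add]
  map_smul' c f := by
    rw [RingHom.id_apply, ← MemLp.toLp_const_smul]
    refine MemLp.toLp_congr _ _ ?_
    filter_upwards [Lp.coeFn_smul c f] with t ht
    rw [ht, Pi.smul_apply, Pi.smul_apply, smul_eq_mul, smul_eq_mul, mul_left_comm]

lemma coeFn_edgeMul (m : C(ℝ, ℝ)) (f : EdgeL2) :
    edgeMul m f =ᵐ[volume.restrict (Ioo (0 : ℝ) 1)] fun t => (m t : ℂ) * f t :=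
  (memLp_mul_continuous m f).coeFn_toLp

lemma norm_edgeMul_le {m : C(ℝ, ℝ)} {C : ℝ} (hC : ∀ t ∈ Icc (0 : ℝ) 1, |m t| ≤ C) (f : EdgeL2) :
    ‖edgeMul m f‖ ≤ C * ‖f‖ := by
  refine Lp.norm_le_mul_norm_of_ae_le_mul ?_
  filter_upwards [coeFn_edgeMul m f, ae_restrict_mem measurableSet_Ioo] with t ht ht'
  rw [ht, norm_mul, Complex.norm_real]
  gcongr
  exact hC t (Ioo_subset_Icc_self ht')

lemma inner_edgeMul_left (m : C(ℝ, ℝ)) (f g : EdgeL2) :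
    ⟪edgeMul m f, g⟫_ℂ = ⟪f, edgeMul m g⟫_ℂ := by
  rw [L2.inner_def, L2.inner_def]
  refine integral_congr_ae ?_
  filter_upwards [coeFn_edgeMul m f, coeFn_edgeMul m g] with t h1 h2
  rw [h1, h2]
  simp [mul_left_comm, mul_assoc]

/-- The product rule for a Sobolev function and a continuously differentiable function. -/
lemma HasSobolevRep.edgeMul {f g : EdgeL2} {F : ℝ → ℂ} (h : HasSobolevRep f g F)
    {m m' : C(ℝ, ℝ)} (hm : ∀ t, HasDerivAt m (m' t) t) :
    HasSobolevRep (edgeMul m f) (edgeMul m g + edgeMul m' f) (fun t => (m t : ℂ) * F t) := by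
  refine ⟨?_, fun x hx => ?_⟩
  · filter_upwards [coeFn_edgeMul m f, h.1] with t h1 h2
    rw [h1, h2]
  · have hm'i : IntervalIntegrable (fun t => (m' t : ℂ)) volume 0 1 :=
      (Complex.continuous_ofReal.comp m'.continuous).intervalIntegrable _ _
    have key := primitive_mul_primitive (F := fun t => (m t : ℂ)) hm'i
      (edgeL2_intervalIntegrable g (x := 1) (by simp)) (fun y _ => by
        rw [intervalIntegral.integral_eq_sub_of_hasDerivAt (fun t _ => (hm t).ofReal_comp)
          ((Complex.continuous_ofReal.comp m'.continuous).intervalIntegrable _ _)]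
        ring) h.2 x hx
    simp only at key ⊢
    rw [key, add_right_inj]
    refine (edgeL2_ae_interval ?_ hx).symm
    filter_upwards [Lp.coeFn_add (QuantumGraph.edgeMul m g) (QuantumGraph.edgeMul m' f),
      coeFn_edgeMul m g, coeFn_edgeMul m' f, h.1] with t h1 h2 h3 h4
    rw [h1, Pi.add_apply, h2, h3, h4]
    ring

/-- Integration by parts on an edge, when one factor vanishes at both endpoints. -/
lemma HasSobolevRep.inner_deriv_add {f g f₂ g₂ : EdgeL2} {F F₂ : ℝ → ℂ} (h : HasSobolevRep f g F)
    (h₂ : HasSobolevRep f₂ g₂ F₂) (h0 : F₂ 0 = 0) (h1 : F₂ 1 = 0) :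
    ⟪g, f₂⟫_ℂ + ⟪f, g₂⟫_ℂ = 0 := by
  have hg := edgeL2_intervalIntegrable g (x := 1) (by simp)
  have hg₂ := edgeL2_intervalIntegrable g₂ (x := 1) (by simp)
  have hgc : IntervalIntegrable (fun t => star (g t)) volume 0 1 :=
    ⟨Complex.conjCLE.toContinuousLinearMap.integrable_comp hg.1,
      Complex.conjCLE.toContinuousLinearMap.integrable_comp hg.2⟩
  have hF : ∀ x ∈ Icc (0 : ℝ) 1, star (F x) = star (F 0) + ∫ t in (0 : ℝ)..x, star (g t) := by
    intro x hx
    have := Complex.conjCLE.toContinuousLinearMap.intervalIntegral_comp_comm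
      (edgeL2_intervalIntegrable g hx)
    rw [h.2 x hx, star_add]
    congr 1
    simpa using this.symm
  have key := primitive_mul_primitive hgc hg₂ hF h₂.2 1 (by simp)
  rw [h0, h1, mul_zero, mul_zero, zero_add, intervalIntegral.integral_of_le zero_le_one,
    integral_Ioc_eq_integral_Ioo] at key
  rw [L2.inner_def, L2.inner_def, ← integral_add (L2.integrable_inner _ _)
    (L2.integrable_inner _ _), key]
  refine integral_congr_ae ?_
  filter_upwards [h.1, h₂.1] with t e1 e2
  rw [e1, e2]
  simp [mul_comm]

/-! ### Multiplication operators on the graph -/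

/-- A uniformly bounded family of continuous real functions on the edges in `S`. Each function is
given on all of `ℝ`, but only its values on `[0,1]` matter. -/
structure Multiplier {d : ℕ} (S : Set (Edge d)) where
  /-- The function on each edge. -/
  fn : S → C(ℝ, ℝ)
  bound : ∃ C : ℝ, ∀ e, ∀ t ∈ Icc (0 : ℝ) 1, |fn e t| ≤ C

lemma Multiplier.memℓp {d : ℕ} {S : Set (Edge d)} (m : Multiplier S) (f : GraphL2 S) :
    Memℓp (fun e => edgeMul (m.fn e) (f e)) 2 := by
  obtain ⟨C, hC⟩ := m.bound
  refine (lp.memℓp ((C : ℂ) • f)).mono' fun e => ?_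
  rw [lp.coeFn_smul, Pi.smul_apply, norm_smul, Complex.norm_real]
  refine (norm_edgeMul_le (hC e) (f e)).trans ?_
  gcongr
  exact le_abs_self C

/-- Multiplication by a bounded family of continuous functions on `L_2` of the graph. -/
def graphMul {d : ℕ} {S : Set (Edge d)} (m : Multiplier S) : GraphL2 S →ₗ[ℂ] GraphL2 S where
  toFun f := (⟨fun e => edgeMul (m.fn e) (f e), m.memℓp f⟩ : GraphL2 S)
  map_add' f g := lp.ext (funext fun e => by
    change edgeMul (m.fn e) ((f + g) e) = edgeMul (m.fn e) (f e) + edgeMul (m.fn e) (g e)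
    rw [lp.coeFn_add, Pi.add_apply, map_add])
  map_smul' c f := lp.ext (funext fun e => by
    change edgeMul (m.fn e) ((c • f) e) = c • edgeMul (m.fn e) (f e)
    rw [lp.coeFn_smul, Pi.smul_apply, map_smul])

section

variable {d : ℕ} {S : Set (Edge d)}

lemma graphMul_apply (m : Multiplier S) (f : GraphL2 S) (e : S) :
    graphMul m f e = edgeMul (m.fn e) (f e) := rfl

lemma norm_graphMul_le {m : Multiplier S} {C : ℝ} (hC0 : 0 ≤ C)
    (hC : ∀ e, ∀ t ∈ Icc (0 : ℝ) 1, |m.fn e t| ≤ C) (f : GraphL2 S) :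
    ‖graphMul m f‖ ≤ C * ‖f‖ := by
  have h : ‖graphMul m f‖ ≤ ‖(C : ℂ) • f‖ := by
    refine lp.norm_mono two_ne_zero fun e => ?_
    rw [lp.coeFn_smul, Pi.smul_apply, norm_smul, Complex.norm_real, Real.norm_of_nonneg hC0]
    exact norm_edgeMul_le (hC e) (f e)
  rwa [norm_smul, Complex.norm_real, Real.norm_of_nonneg hC0] at h

lemma inner_graphMul_left (m : Multiplier S) (f g : GraphL2 S) :
    ⟪graphMul m f, g⟫_ℂ = ⟪f, graphMul m g⟫_ℂ := by
  rw [lp.inner_eq_tsum, lp.inner_eq_tsum]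
  exact tsum_congr fun e => inner_edgeMul_left _ _ _

/-- Pointwise linear relations between products of multipliers are inherited by the operators. -/
lemma graphMul_eq_of_pointwise {m a b c a' : Multiplier S} {x y : ℝ}
    (h : ∀ e, ∀ t, m.fn e t = x * (a.fn e t * b.fn e t) + y * (a'.fn e t * c.fn e t))
    (f : GraphL2 S) :
    graphMul m f = (x : ℂ) • graphMul a (graphMul b f) +
      (y : ℂ) • graphMul a' (graphMul c f) := by
  refine lp.ext (funext fun e => Lp.ext ?_)
  rw [lp.coeFn_add, Pi.add_apply, lp.coeFn_smul, lp.coeFn_smul, Pi.smul_apply, Pi.smul_apply]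
  simp only [graphMul_apply]
  filter_upwards [coeFn_edgeMul (m.fn e) (f e),
    Lp.coeFn_add ((x : ℂ) • edgeMul (a.fn e) (edgeMul (b.fn e) (f e)))
      ((y : ℂ) • edgeMul (a'.fn e) (edgeMul (c.fn e) (f e))),
    Lp.coeFn_smul (x : ℂ) (edgeMul (a.fn e) (edgeMul (b.fn e) (f e))),
    Lp.coeFn_smul (y : ℂ) (edgeMul (a'.fn e) (edgeMul (c.fn e) (f e))),
    coeFn_edgeMul (a.fn e) (edgeMul (b.fn e) (f e)), coeFn_edgeMul (b.fn e) (f e),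
    coeFn_edgeMul (a'.fn e) (edgeMul (c.fn e) (f e)), coeFn_edgeMul (c.fn e) (f e)]
    with t h1 h2 h3 h4 h5 h6 h7 h8
  rw [h1, h2, Pi.add_apply, h3, h4, Pi.smul_apply, Pi.smul_apply, h5, h6, h7, h8, h e t]
  push_cast
  simp only [smul_eq_mul]
  ring

lemma graphMul_comm (a b : Multiplier S) (f : GraphL2 S) :
    graphMul a (graphMul b f) = graphMul b (graphMul a f) := by
  refine lp.ext (funext fun e => Lp.ext ?_)
  simp only [graphMul_apply]
  filter_upwards [coeFn_edgeMul (a.fn e) (edgeMul (b.fn e) (f e)), coeFn_edgeMul (b.fn e) (f e),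
    coeFn_edgeMul (b.fn e) (edgeMul (a.fn e) (f e)), coeFn_edgeMul (a.fn e) (f e)]
    with t h1 h2 h3 h4
  rw [h1, h2, h3, h4]
  ring

/-- Multiplication by a `C^1` family that is continuous at the vertices preserves `W_2^1`. -/
lemma HasGraphDeriv.graphMul {f f' : GraphL2 S} (h : HasGraphDeriv f f') {m m' : Multiplier S}
    (hm : ∀ e t, HasDerivAt (m.fn e) (m'.fn e t) t) {ψ : (Fin d → ℤ) → ℝ}
    (h0 : ∀ e : S, m.fn e 0 = ψ e.1.init) (h1 : ∀ e : S, m.fn e 1 = ψ e.1.term) :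
    HasGraphDeriv (graphMul m f) (graphMul m f' + graphMul m' f) := by
  obtain ⟨F, φ, hF⟩ := h
  refine ⟨fun e t => (m.fn e t : ℂ) * F e t, fun v => (ψ v : ℂ) * φ v, fun e => ⟨?_, ?_, ?_⟩⟩
  · exact (hF e).1.edgeMul (hm e)
  · simp only [h0, (hF e).2.1]
  · simp only [h1, (hF e).2.2]

/-- Integration by parts on the graph against a multiplier that vanishes at all vertices. -/
lemma HasGraphDeriv.inner_deriv_graphMul {f f' g g' : GraphL2 S} (hf : HasGraphDeriv f f')
    (hg : HasGraphDeriv g g') {k k' : Multiplier S}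
    (hk : ∀ e t, HasDerivAt (k.fn e) (k'.fn e t) t)
    (h0 : ∀ e : S, k.fn e 0 = 0) (h1 : ∀ e : S, k.fn e 1 = 0) :
    ⟪f', QuantumGraph.graphMul k g⟫_ℂ +
      ⟪f, QuantumGraph.graphMul k g' + QuantumGraph.graphMul k' g⟫_ℂ = 0 := by
  obtain ⟨F, φ, hF⟩ := hf
  obtain ⟨G, χ, hG⟩ := hg
  have s := (lp.hasSum_inner (𝕜 := ℂ) f' (QuantumGraph.graphMul k g)).add
    (lp.hasSum_inner (𝕜 := ℂ) f (QuantumGraph.graphMul k g' + QuantumGraph.graphMul k' g))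
  refine s.unique ?_
  convert! hasSum_zero (α := ℂ) (β := S) using 1
  funext e
  exact (hF e).1.inner_deriv_add ((hG e).1.edgeMul (hk e)) (by simp [h0]) (by simp [h1])

/-! ### Conjugation of the operator by a multiplier -/

/-- The potential `ω` as a multiplier. -/
def potential {qm qp : ℝ} (ω : Config d qm qp) (S : Set (Edge d)) : Multiplier S where
  fn e := ContinuousMap.const ℝ (ω e : ℝ)
  bound := ⟨max |qm| |qp|, fun e _ _ => abs_le_max_abs_abs (ω e).2.1 (ω e).2.2⟩

lemma edgeMul_const (x : ℝ) (f : EdgeL2) : edgeMul (ContinuousMap.const ℝ x) f = (x : ℂ) • f := by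
  refine Lp.ext ?_
  filter_upwards [coeFn_edgeMul (ContinuousMap.const ℝ x) f, Lp.coeFn_smul (x : ℂ) f] with t h1 h2
  rw [h1, h2]
  simp

lemma form_eq_inner {qm qp : ℝ} (ω : Config d qm qp) (u v : W12 S) :
    form ω S u v = ⟪graphDeriv u, graphDeriv v⟫_ℂ +
      ⟪(u : GraphL2 S), graphMul (potential ω S) v⟫_ℂ := by
  refine HasSum.tsum_eq ?_
  convert! (lp.hasSum_inner (𝕜 := ℂ) (graphDeriv u) (graphDeriv v)).add
    (lp.hasSum_inner (𝕜 := ℂ) (u : GraphL2 S) (graphMul (potential ω S) v)) using 1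
  funext e
  rw [graphMul_apply]
  change _ = _ + ⟪_, edgeMul (ContinuousMap.const ℝ (ω e : ℝ)) _⟫_ℂ
  rw [edgeMul_const, inner_smul_right]

lemma mem_hamiltonianGraph_iff {qm qp : ℝ} {ω : Config d qm qp} {u f : GraphL2 S} :
    (u, f) ∈ hamiltonianGraph ω S ↔ ∃ u', HasGraphDeriv u u' ∧ ∀ v v', HasGraphDeriv v v' →
      ⟪v', u'⟫_ℂ + ⟪v, graphMul (potential ω S) u⟫_ℂ = ⟪v, f⟫_ℂ := by
  constructor
  · rintro ⟨w, hw, h⟩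
    simp only at hw
    subst hw
    refine ⟨graphDeriv w, hasGraphDeriv_graphDeriv w, fun v v' hv => ?_⟩
    have := h ⟨v, v', hv⟩
    rw [form_eq_inner, (hasGraphDeriv_graphDeriv ⟨v, v', hv⟩).unique hv] at this
    exact this
  · rintro ⟨u', hu, h⟩
    refine ⟨⟨u, u', hu⟩, rfl, fun v => ?_⟩
    rw [form_eq_inner, (hasGraphDeriv_graphDeriv ⟨u, u', hu⟩).unique hu]
    exact h _ _ (hasGraphDeriv_graphDeriv v)

/-- If `H u = f`, then `m u` belongs to the domain of `H` and `H (m u) = m f - 2 m' u' - m'' u`,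
provided that `m'` vanishes at the vertices, so that the Kirchhoff conditions are preserved. -/
lemma graphMul_mem_hamiltonianGraph {qm qp : ℝ} {ω : Config d qm qp} {u u' f : GraphL2 S}
    (hu : (u, f) ∈ hamiltonianGraph ω S) (hu' : HasGraphDeriv u u') {m m' m'' : Multiplier S}
    (hm : ∀ e t, HasDerivAt (m.fn e) (m'.fn e t) t)
    (hm' : ∀ e t, HasDerivAt (m'.fn e) (m''.fn e t) t) {ψ : (Fin d → ℤ) → ℝ}
    (h0 : ∀ e : S, m.fn e 0 = ψ e.1.init) (h1 : ∀ e : S, m.fn e 1 = ψ e.1.term)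
    (h0' : ∀ e : S, m'.fn e 0 = 0) (h1' : ∀ e : S, m'.fn e 1 = 0) :
    (graphMul m u, graphMul m f - (2 : ℂ) • graphMul m' u' - graphMul m'' u) ∈
      hamiltonianGraph ω S := by
  obtain ⟨u₁, hu₁, h⟩ := mem_hamiltonianGraph_iff.1 hu
  obtain rfl := hu₁.unique hu'
  refine mem_hamiltonianGraph_iff.2 ⟨_, hu'.graphMul hm h0 h1, fun v v' hv => ?_⟩
  have e1 := h _ _ (hv.graphMul hm h0 h1)
  have e2 := hv.inner_deriv_graphMul hu' hm' h0' h1'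
  rw [inner_add_left, inner_graphMul_left, inner_graphMul_left, inner_graphMul_left,
    inner_graphMul_left, graphMul_comm m (potential ω S)] at e1
  simp only [inner_add_right, inner_sub_right, inner_smul_right] at e2 ⊢
  linear_combination e1 + e2

/-- The operator `H` is symmetric. -/
lemma hamiltonianGraph_symmetric {qm qp : ℝ} {ω : Config d qm qp} {u f v g : GraphL2 S}
    (hu : (u, f) ∈ hamiltonianGraph ω S) (hv : (v, g) ∈ hamiltonianGraph ω S) :
    ⟪f, v⟫_ℂ = ⟪u, g⟫_ℂ := by
  obtain ⟨u', hu', h⟩ := mem_hamiltonianGraph_iff.1 hu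
  obtain ⟨v', hv', k⟩ := mem_hamiltonianGraph_iff.1 hv
  rw [← k _ _ hu', ← inner_conj_symm, ← h _ _ hv', map_add, inner_conj_symm, inner_conj_symm,
    inner_graphMul_left]

/-- The form controls the derivative: `‖u'‖² ≤ Re (u | H u) - q₋ ‖u‖²`. -/
lemma norm_deriv_sq_le {qm qp : ℝ} {ω : Config d qm qp} {u u' f : GraphL2 S}
    (hu : (u, f) ∈ hamiltonianGraph ω S) (hu' : HasGraphDeriv u u') :
    ‖u'‖ ^ 2 ≤ (⟪u, f⟫_ℂ).re - qm * ‖u‖ ^ 2 := by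
  obtain ⟨u₁, hu₁, h⟩ := mem_hamiltonianGraph_iff.1 hu
  obtain rfl := hu₁.unique hu'
  have e := congrArg Complex.re (h _ _ hu')
  have e1 : (⟪u₁, u₁⟫_ℂ).re = ‖u₁‖ ^ 2 := inner_self_eq_norm_sq (𝕜 := ℂ) u₁
  have e2 : qm * ‖u‖ ^ 2 ≤ (⟪u, graphMul (potential ω S) u⟫_ℂ).re := by
    have s1 := (lp.hasSum_inner (𝕜 := ℂ) u u).mapL Complex.reCLM |>.mul_left qm
    have s2 := (lp.hasSum_inner (𝕜 := ℂ) u (graphMul (potential ω S) u)).mapL Complex.reCLM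
    have : (⟪u, u⟫_ℂ).re = ‖u‖ ^ 2 := inner_self_eq_norm_sq (𝕜 := ℂ) u
    rw [← this]
    refine hasSum_le (fun e => ?_) s1 s2
    rw [graphMul_apply]
    change _ ≤ (⟪_, edgeMul (ContinuousMap.const ℝ (ω e : ℝ)) _⟫_ℂ).re
    have h3 : (⟪u e, u e⟫_ℂ).re = ‖u e‖ ^ 2 := inner_self_eq_norm_sq (𝕜 := ℂ) (u e)
    rw [edgeMul_const, inner_smul_right, Complex.re_ofReal_mul, Complex.reCLM_apply, h3]
    gcongr
    exact (ω e).2.1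
  rw [Complex.add_re] at e
  linarith

end

/-! ### Symmetric operators with a spectral gap -/

section

variable {X : Type*} [NormedAddCommGroup X] [InnerProductSpace ℂ X]

/-- The resolvent identity. -/
lemma IsResolvent.eq_add {T : X →ₗ.[ℂ] X} {z z' : ℂ} {B B' : X →L[ℂ] X}
    (h : IsResolvent T z B) (h' : IsResolvent T z' B') : B = B' + (z - z') • (B' * B) := by
  ext f
  obtain ⟨u, hu, hf⟩ := h.2 f
  have h1 := h'.1 u
  have h2 : T u - z' • (u : X) = f + (z - z') • (u : X) := by
    rw [← hf, sub_smul]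
    abel
  rw [h2, map_add, map_smul, hu] at h1
  exact h1.symm

lemma IsResolvent.isSelfAdjoint [CompleteSpace X] {T : X →ₗ.[ℂ] X}
    (hT : ∀ u v : T.domain, ⟪T u, (v : X)⟫_ℂ = ⟪(u : X), T v⟫_ℂ) {x : ℝ} {B : X →L[ℂ] X}
    (h : IsResolvent T x B) : IsSelfAdjoint B := by
  rw [ContinuousLinearMap.isSelfAdjoint_iff_isSymmetric]
  intro f g
  obtain ⟨u, hu, hf⟩ := h.2 f
  obtain ⟨v, hv, hg⟩ := h.2 g
  change ⟪B f, g⟫_ℂ = ⟪f, B g⟫_ℂ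
  rw [← hu, ← hv, ← hf, ← hg, inner_sub_left, inner_sub_right, hT, inner_smul_left,
    inner_smul_right, Complex.conj_ofReal]

/-- For a symmetric operator the resolvent at the midpoint of a gap `(r, s)` has norm at most
`2 / (s - r)`: it is self-adjoint, so that its norm is its spectral radius, and a real `z ≠ 0`
belongs to its spectrum only if `(r + s) / 2 + z⁻¹` lies outside the gap. -/
lemma norm_resolvent_midpoint_le [CompleteSpace X] {T : X →ₗ.[ℂ] X}
    (hT : ∀ u v : T.domain, ⟪T u, (v : X)⟫_ℂ = ⟪(u : X), T v⟫_ℂ) {r s : ℝ} (hrs : r < s)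
    (hres : ∀ t ∈ Ioo r s, (t : ℂ) ∈ resolventSet T) {B : X →L[ℂ] X}
    (hB : IsResolvent T (((r + s) / 2 : ℝ) : ℂ) B) : ‖B‖ ≤ 2 / (s - r) := by
  have hsa := hB.isSelfAdjoint hT
  have hpos : 0 < s - r := sub_pos.2 hrs
  have hspec : ∀ z ∈ spectrum ℂ B, ‖z‖ ≤ 2 / (s - r) := by
    intro z hz
    have hzre := hsa.mem_spectrum_eq_re hz
    by_contra! hlt
    rw [hzre, Complex.norm_real, Real.norm_eq_abs] at hlt
    set x : ℝ := z.re
    have hx0 : x ≠ 0 := by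
      rintro h0
      rw [h0, abs_zero] at hlt
      exact absurd hlt (not_lt.2 (by positivity))
    have hinv : |x⁻¹| < (s - r) / 2 := by
      rw [abs_inv, ← inv_div]
      exact inv_strictAnti₀ (by positivity) hlt
    obtain ⟨B', hB'⟩ := hres ((r + s) / 2 + x⁻¹)
      ⟨by linarith [(abs_lt.1 hinv).1], by linarith [(abs_lt.1 hinv).2]⟩
    have e1 := hB.eq_add hB'
    have e2 := hB'.eq_add hB
    have hc : (((r + s) / 2 : ℝ) : ℂ) - (((r + s) / 2 + x⁻¹ : ℝ) : ℂ) = -(x : ℂ)⁻¹ := by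
      push_cast; ring
    have hc' : (((r + s) / 2 + x⁻¹ : ℝ) : ℂ) - (((r + s) / 2 : ℝ) : ℂ) = (x : ℂ)⁻¹ := by
      push_cast; ring
    rw [hc] at e1
    rw [hc'] at e2
    have hxc : (x : ℂ) ≠ 0 := Complex.ofReal_ne_zero.2 hx0
    have p1 : B' * B = (x : ℂ) • (B' - B) := by
      have : B' - B = (x : ℂ)⁻¹ • (B' * B) := by
        nth_rw 1 [e1]
        simp
      rw [this, smul_inv_smul₀ hxc]
    have p2 : B * B' = (x : ℂ) • (B' - B) := by
      have : B' - B = (x : ℂ)⁻¹ • (B * B') := by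
        nth_rw 1 [e2]
        simp
      rw [this, smul_inv_smul₀ hxc]
    -- `B - x = -x (T - t) (T - (r + s) / 2)⁻¹` with `t = (r + s) / 2 + x⁻¹`, which is inverted by
    -- means of `(T - t)⁻¹`.
    refine hz (isUnit_iff_exists.2 ⟨(x : ℂ)⁻¹ • (1 + (x : ℂ)⁻¹ • B'), ?_, ?_⟩)
    · rw [hzre, Algebra.algebraMap_eq_smul_one]
      simp only [mul_add, sub_mul, smul_mul_assoc, mul_smul_comm, one_mul, mul_one, p2]
      match_scalars <;> field_simp <;> ring
    · rw [hzre, Algebra.algebraMap_eq_smul_one]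
      simp only [add_mul, mul_sub, smul_mul_assoc, mul_smul_comm, one_mul, mul_one, p1]
      match_scalars <;> field_simp <;> ring
  have h2 : spectralRadius ℂ B ≤ ENNReal.ofReal (2 / (s - r)) :=
    iSup₂_le fun z hz => by
      rw [← enorm_eq_nnnorm, ← ofReal_norm]
      exact ENNReal.ofReal_le_ofReal (hspec z hz)
  rw [hsa.spectralRadius_eq_nnnorm, ← enorm_eq_nnnorm, ← ofReal_norm] at h2
  exact (ENNReal.ofReal_le_ofReal_iff (by positivity)).1 h2

/-- In the gap `(r, s)`, `(T - r) (T - s) ≥ 0`, written in terms of `T - E` for `E` in the gap. -/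
lemma gap_inequality [CompleteSpace X] {T : X →ₗ.[ℂ] X}
    (hT : ∀ u v : T.domain, ⟪T u, (v : X)⟫_ℂ = ⟪(u : X), T v⟫_ℂ) {r s : ℝ} (hrs : r < s)
    (hres : ∀ t ∈ Ioo r s, (t : ℂ) ∈ resolventSet T) (E : ℝ) (u : T.domain) :
    ((s - E) - (E - r)) * (⟪(u : X), T u - (E : ℂ) • (u : X)⟫_ℂ).re +
      (E - r) * (s - E) * ‖(u : X)‖ ^ 2 ≤ ‖T u - (E : ℂ) • (u : X)‖ ^ 2 := by
  obtain ⟨B, hB⟩ := hres ((r + s) / 2) ⟨by linarith, by linarith⟩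
  have hpos : 0 < s - r := sub_pos.2 hrs
  have h1 : ‖(u : X)‖ ≤ 2 / (s - r) * ‖T u - (((r + s) / 2 : ℝ) : ℂ) • (u : X)‖ := by
    conv_lhs => rw [← hB.1 u]
    exact (B.le_opNorm _).trans (by gcongr; exact norm_resolvent_midpoint_le hT hrs hres hB)
  set p : X := T u - (E : ℂ) • (u : X) with hp
  set k : ℝ := (r + s) / 2 - E with hk
  have h2 : T u - (((r + s) / 2 : ℝ) : ℂ) • (u : X) = p - (k : ℂ) • (u : X) := by
    rw [hp, sub_sub, ← add_smul, hk]
    congr 2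
    push_cast; ring
  rw [h2, div_mul_eq_mul_div, le_div_iff₀ hpos] at h1
  have h3 : ‖p - (k : ℂ) • (u : X)‖ ^ 2 =
      ‖p‖ ^ 2 - 2 * (k * (⟪(u : X), p⟫_ℂ).re) + k ^ 2 * ‖(u : X)‖ ^ 2 := by
    rw [norm_sub_sq (𝕜 := ℂ), norm_smul, Complex.norm_real, mul_pow, Real.norm_eq_abs, sq_abs,
      ← inner_re_symm, inner_smul_left, Complex.conj_ofReal]
    congr 3
    exact Complex.re_ofReal_mul _ _
  have h4 : (‖(u : X)‖ * (s - r)) ^ 2 ≤ (2 * ‖p - (k : ℂ) • (u : X)‖) ^ 2 := by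
    gcongr
  rw [mul_pow 2, h3] at h4
  rw [hk] at h4
  nlinarith [h4]

end

/-! ### Weights interpolating between vertex values -/

/-- The cubic interpolation between the values `p` at `0` and `q` at `1`, with vanishing
derivative at both ends. -/
def interp (p q : ℝ) : C(ℝ, ℝ) := ⟨fun t => p + (q - p) * (3 * t ^ 2 - 2 * t ^ 3), by fun_prop⟩

/-- The derivative of `interp`. -/
def interpDeriv (p q : ℝ) : C(ℝ, ℝ) := ⟨fun t => (q - p) * (6 * t - 6 * t ^ 2), by fun_prop⟩

/-- The second derivative of `interp`. -/
def interpDeriv₂ (p q : ℝ) : C(ℝ, ℝ) := ⟨fun t => (q - p) * (6 - 12 * t), by fun_prop⟩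

lemma interp_zero (p q : ℝ) : interp p q 0 = p := by simp [interp]

lemma interp_one (p q : ℝ) : interp p q 1 = q := by
  simp only [interp, ContinuousMap.coe_mk]
  ring

lemma hasDerivAt_interp (p q t : ℝ) : HasDerivAt (interp p q) (interpDeriv p q t) t := by
  have h := ((((hasDerivAt_pow 2 t).const_mul 3).sub ((hasDerivAt_pow 3 t).const_mul 2)).const_mul
    (q - p)).const_add p
  convert! h using 1
  simp only [interpDeriv, ContinuousMap.coe_mk]
  push_cast
  ring

lemma hasDerivAt_interpDeriv (p q t : ℝ) :
    HasDerivAt (interpDeriv p q) (interpDeriv₂ p q t) t := by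
  have h := (((hasDerivAt_id t).const_mul 6).sub ((hasDerivAt_pow 2 t).const_mul 6)).const_mul
    (q - p)
  convert! h using 1
  simp only [interpDeriv₂, ContinuousMap.coe_mk]
  push_cast
  ring

lemma interp_mem_Icc {p q D t : ℝ} (hp : p ∈ Icc 0 D) (hq : q ∈ Icc 0 D) (ht : t ∈ Icc (0 : ℝ) 1) :
    interp p q t ∈ Icc 0 D := by
  have h0 : 0 ≤ 3 * t ^ 2 - 2 * t ^ 3 := by nlinarith [ht.1, ht.2, sq_nonneg t]
  have h1 : 0 ≤ 1 - (3 * t ^ 2 - 2 * t ^ 3) := by nlinarith [ht.1, ht.2, sq_nonneg (1 - t)]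
  have e : interp p q t = (1 - (3 * t ^ 2 - 2 * t ^ 3)) * p + (3 * t ^ 2 - 2 * t ^ 3) * q := by
    simp only [interp, ContinuousMap.coe_mk]
    ring
  rw [e]
  constructor
  · exact add_nonneg (mul_nonneg h1 hp.1) (mul_nonneg h0 hq.1)
  · nlinarith [mul_nonneg h1 (sub_nonneg.2 hp.2), mul_nonneg h0 (sub_nonneg.2 hq.2)]

lemma abs_interpDeriv_le {p q t : ℝ} (hpq : |q - p| ≤ 1) (ht : t ∈ Icc (0 : ℝ) 1) :
    |interpDeriv p q t| ≤ 2 := by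
  have h : |6 * t - 6 * t ^ 2| ≤ 2 :=
    abs_le.2 ⟨by nlinarith [ht.1, ht.2], by nlinarith [sq_nonneg (2 * t - 1)]⟩
  simp only [interpDeriv, ContinuousMap.coe_mk, abs_mul]
  nlinarith [abs_nonneg (q - p), abs_nonneg (6 * t - 6 * t ^ 2)]

lemma abs_interpDeriv₂_le {p q t : ℝ} (hpq : |q - p| ≤ 1) (ht : t ∈ Icc (0 : ℝ) 1) :
    |interpDeriv₂ p q t| ≤ 6 := by
  have h : |6 - 12 * t| ≤ 6 := abs_le.2 ⟨by linarith [ht.2], by linarith [ht.1]⟩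
  simp only [interpDeriv₂, ContinuousMap.coe_mk, abs_mul]
  nlinarith [abs_nonneg (q - p), abs_nonneg (6 - 12 * t)]

/-- The product of two multipliers. -/
def Multiplier.mul {d : ℕ} {S : Set (Edge d)} (a b : Multiplier S) : Multiplier S where
  fn e := a.fn e * b.fn e
  bound := by
    obtain ⟨x, hx⟩ := a.bound
    obtain ⟨y, hy⟩ := b.bound
    refine ⟨x * y, fun e t ht => ?_⟩
    rw [ContinuousMap.mul_apply, abs_mul]
    exact mul_le_mul (hx e t ht) (hy e t ht) (abs_nonneg _) ((abs_nonneg _).trans (hx e t ht))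

/-- A linear combination of two multipliers. -/
def Multiplier.lin {d : ℕ} {S : Set (Edge d)} (x y : ℝ) (a b : Multiplier S) : Multiplier S where
  fn e := x • a.fn e + y • b.fn e
  bound := by
    obtain ⟨p, hp⟩ := a.bound
    obtain ⟨q, hq⟩ := b.bound
    refine ⟨|x| * p + |y| * q, fun e t ht => ?_⟩
    simp only [ContinuousMap.add_apply, ContinuousMap.smul_apply, smul_eq_mul]
    refine (abs_add_le _ _).trans ?_
    rw [abs_mul, abs_mul]
    gcongr
    · exact hp e t ht
    · exact hq e t ht

/-- A function on the vertices with values in `[0, D]` that varies by at most one along each edge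
in `S`. -/
structure VertexWeight {d : ℕ} (S : Set (Edge d)) (D : ℝ) where
  /-- The value at a vertex. -/
  val : (Fin d → ℤ) → ℝ
  mem_Icc : ∀ v, val v ∈ Icc 0 D
  lip : ∀ e ∈ S, |val e.term - val e.init| ≤ 1

namespace VertexWeight

variable {d : ℕ} {S : Set (Edge d)} {D : ℝ}

/-- The derivative of the interpolation of a vertex weight along the edges. -/
def deriv₁ (φ : VertexWeight S D) : Multiplier S where
  fn e := interpDeriv (φ.val e.1.init) (φ.val e.1.term)
  bound := ⟨2, fun e _ ht => abs_interpDeriv_le (φ.lip e e.2) ht⟩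

/-- The second derivative of the interpolation of a vertex weight along the edges. -/
def deriv₂ (φ : VertexWeight S D) : Multiplier S where
  fn e := interpDeriv₂ (φ.val e.1.init) (φ.val e.1.term)
  bound := ⟨6, fun e _ ht => abs_interpDeriv₂_le (φ.lip e e.2) ht⟩

lemma norm_deriv₁_le (φ : VertexWeight S D) (f : GraphL2 S) :
    ‖graphMul φ.deriv₁ f‖ ≤ 2 * ‖f‖ :=
  norm_graphMul_le (by norm_num) (fun e _ ht => abs_interpDeriv_le (φ.lip e e.2) ht) f

lemma norm_deriv₂_le (φ : VertexWeight S D) (f : GraphL2 S) :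
    ‖graphMul φ.deriv₂ f‖ ≤ 6 * ‖f‖ :=
  norm_graphMul_le (by norm_num) (fun e _ ht => abs_interpDeriv₂_le (φ.lip e e.2) ht) f

/-- The function `exp (ε w)`, where `w` is the interpolation of a vertex weight. -/
def exp (φ : VertexWeight S D) (ε : ℝ) : Multiplier S where
  fn e := ⟨fun t => Real.exp (ε * interp (φ.val e.1.init) (φ.val e.1.term) t), by fun_prop⟩
  bound := ⟨Real.exp (|ε| * D), fun e t ht => by
    have h := interp_mem_Icc (φ.mem_Icc e.1.init) (φ.mem_Icc e.1.term) ht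
    rw [ContinuousMap.coe_mk, abs_of_pos (Real.exp_pos _), Real.exp_le_exp]
    exact mul_le_mul (le_abs_self ε) h.2 h.1 (abs_nonneg ε)⟩

/-- The derivative `ε w' exp (ε w)`. The second coefficient of the linear combination is zero. -/
def expDeriv (φ : VertexWeight S D) (ε : ℝ) : Multiplier S :=
  .lin ε 0 (φ.deriv₁.mul (φ.exp ε)) (φ.deriv₁.mul (φ.exp ε))

/-- The second derivative `ε w'' exp (ε w) + ε w' (exp (ε w))'`. -/
def expDeriv₂ (φ : VertexWeight S D) (ε : ℝ) : Multiplier S :=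
  .lin ε ε (φ.deriv₂.mul (φ.exp ε)) (φ.deriv₁.mul (φ.expDeriv ε))

lemma graphMul_expDeriv (φ : VertexWeight S D) (ε : ℝ) (f : GraphL2 S) :
    graphMul (φ.expDeriv ε) f = (ε : ℂ) • graphMul φ.deriv₁ (graphMul (φ.exp ε) f) := by
  rw [graphMul_eq_of_pointwise (fun e t => rfl : ∀ e : S, ∀ t, (φ.expDeriv ε).fn e t =
    ε * (φ.deriv₁.fn e t * (φ.exp ε).fn e t) + 0 * (φ.deriv₁.fn e t * (φ.exp ε).fn e t)) f]
  simp

lemma graphMul_expDeriv₂ (φ : VertexWeight S D) (ε : ℝ) (f : GraphL2 S) :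
    graphMul (φ.expDeriv₂ ε) f = (ε : ℂ) • graphMul φ.deriv₂ (graphMul (φ.exp ε) f) +
      (ε : ℂ) • graphMul φ.deriv₁ (graphMul (φ.expDeriv ε) f) :=
  graphMul_eq_of_pointwise (fun _ _ => rfl) f

lemma hasDerivAt_exp (φ : VertexWeight S D) (ε : ℝ) (e : S) (t : ℝ) :
    HasDerivAt ((φ.exp ε).fn e) ((φ.expDeriv ε).fn e t) t := by
  have h := ((hasDerivAt_interp (φ.val e.1.init) (φ.val e.1.term) t).const_mul ε).exp
  convert! h using 1
  simp [expDeriv, exp, deriv₁, Multiplier.lin, Multiplier.mul]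
  ring

lemma hasDerivAt_expDeriv (φ : VertexWeight S D) (ε : ℝ) (e : S) (t : ℝ) :
    HasDerivAt ((φ.expDeriv ε).fn e) ((φ.expDeriv₂ ε).fn e t) t := by
  have h := ((hasDerivAt_interpDeriv (φ.val e.1.init) (φ.val e.1.term) t).mul
    (φ.hasDerivAt_exp ε e t)).const_mul ε
  convert! h using 1
  · funext x
    simp [expDeriv, exp, deriv₁, Multiplier.lin, Multiplier.mul]
  · simp [expDeriv₂, exp, deriv₁, deriv₂, Multiplier.lin, Multiplier.mul]
    ring

/-- If `(H - E) g = h` and `u = exp (ε w) g`, where `w = 0` on the support of `h`, then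
`(H - E) u = h - ε (2 w' u' + w'' u) + ε² w'² u`. -/
lemma conjugated_equation (φ : VertexWeight S D) (ε : ℝ) {qm qp : ℝ} {ω : Config d qm qp} {E : ℝ}
    {g h : GraphL2 S} (hg : (g, h + (E : ℂ) • g) ∈ hamiltonianGraph ω S)
    (hh : graphMul (φ.exp ε) h = h) :
    ∃ u', HasGraphDeriv (graphMul (φ.exp ε) g) u' ∧
      (graphMul (φ.exp ε) g,
        h - (ε : ℂ) • ((2 : ℂ) • graphMul φ.deriv₁ u' +
            graphMul φ.deriv₂ (graphMul (φ.exp ε) g)) +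
          ((ε ^ 2 : ℝ) : ℂ) • graphMul φ.deriv₁ (graphMul φ.deriv₁ (graphMul (φ.exp ε) g)) +
          (E : ℂ) • graphMul (φ.exp ε) g) ∈ hamiltonianGraph ω S := by
  obtain ⟨g', hg', -⟩ := mem_hamiltonianGraph_iff.1 hg
  have h0 : ∀ e : S, (φ.exp ε).fn e 0 = Real.exp (ε * φ.val e.1.init) := fun e => by
    simp [exp, interp_zero]
  have h1 : ∀ e : S, (φ.exp ε).fn e 1 = Real.exp (ε * φ.val e.1.term) := fun e => by
    simp [exp, interp_one]
  refine ⟨_, hg'.graphMul (φ.hasDerivAt_exp ε) (ψ := fun v => Real.exp (ε * φ.val v)) h0 h1, ?_⟩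
  convert! graphMul_mem_hamiltonianGraph hg hg' (φ.hasDerivAt_exp ε) (φ.hasDerivAt_expDeriv ε)
    (ψ := fun v => Real.exp (ε * φ.val v)) h0 h1
    (fun e => by simp [expDeriv, deriv₁, interpDeriv, Multiplier.lin, Multiplier.mul])
    (fun e => by simp [expDeriv, deriv₁, interpDeriv, Multiplier.lin, Multiplier.mul]) using 2
  simp only [graphMul_expDeriv₂, graphMul_expDeriv, map_add, map_smul, hh]
  push_cast
  module

/-- The first-order operator `2 w' ∂ + w''` produced by the conjugation is skew-symmetric. -/
lemma re_inner_first_order (φ : VertexWeight S D) {u u' : GraphL2 S} (hu : HasGraphDeriv u u') :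
    (⟪u, (2 : ℂ) • graphMul φ.deriv₁ u' + graphMul φ.deriv₂ u⟫_ℂ).re = 0 := by
  have h := hu.inner_deriv_graphMul hu (k := φ.deriv₁) (k' := φ.deriv₂)
    (fun e t => hasDerivAt_interpDeriv _ _ t) (fun e => by simp [deriv₁, interpDeriv])
    (fun e => by simp [deriv₁, interpDeriv])
  rw [← inner_graphMul_left, ← inner_conj_symm, inner_add_right] at h
  have h' := congrArg Complex.re h
  simp only [Complex.add_re, Complex.conj_re, Complex.zero_re] at h'
  rw [inner_add_right, inner_smul_right, Complex.add_re, Complex.mul_re]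
  simp
  linarith

end VertexWeight

/-! ### The weighted resolvent estimate -/

lemma isResolvent_resolvent {X : Type*} [NormedAddCommGroup X] [NormedSpace ℂ X] {T : X →ₗ.[ℂ] X}
    {z : ℂ} (hz : z ∈ resolventSet T) : IsResolvent T z (resolvent T z) := by
  have h : ∃ B : X →L[ℂ] X, IsResolvent T z B := hz
  rw [resolvent, dif_pos h]
  exact h.choose_spec

/-- The factor of `√(η (s - r))` in the rate of exponential decay. The term `8 √R` makes the
contribution of `ε² w'²` at most `η / 8`; the other two terms, where `√(2 R + |q₋|)` bounds
`‖u'‖ / ‖u‖`, do the same for the first-order term and `√(η (s - r)) / 4`. -/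
def combesThomasRate (qm R : ℝ) : ℝ := (8 * √R + 16 * √(2 * R + |qm|) + 24)⁻¹

lemma combesThomasRate_pos (qm R : ℝ) : 0 < combesThomasRate qm R := by
  rw [combesThomasRate]
  positivity

/-- The quantitative core of the Combes–Thomas estimate. Suppose that the perturbed vector `u`
satisfies `p = h - ε k + ε² l`, where `p` stands for `(H - E) u`, the first-order term `k` is
skew and controlled by the energy, `l` is of order zero, and `ε` is a small multiple of
`√(η (s - r))`. If `‖h‖` were smaller than `η ‖u‖ / 8`, then `u` would be a quasimode with
`‖(H - E) u‖ ≤ √(η (s - r)) ‖u‖ / 2`, while `Re (u | (H - E) u)` is of the smaller order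
`η ‖u‖²` since `k` does not contribute to it. This contradicts the gap inequality. -/
lemma norm_le_of_gap_inequality {X : Type*} [NormedAddCommGroup X] [InnerProductSpace ℂ X]
    {qm R r s E η ε : ℝ} {u u' p h k l : X} (hR : 0 < R) (hr : -R ≤ r) (hs : s ≤ R)
    (hE : E ∈ Ioo r s) (hη : η = min (E - r) (s - E))
    (hε : ε = combesThomasRate qm R * √(η * (s - r)))
    (hp : p = h - (ε : ℂ) • k + ((ε ^ 2 : ℝ) : ℂ) • l) (hk0 : (⟪u, k⟫_ℂ).re = 0)
    (hk : ‖k‖ ≤ 4 * ‖u'‖ + 6 * ‖u‖) (hl : ‖l‖ ≤ 4 * ‖u‖)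
    (hu' : ‖u'‖ ^ 2 ≤ (⟪u, p⟫_ℂ).re + (E - qm) * ‖u‖ ^ 2)
    (hgap : ((s - E) - (E - r)) * (⟪u, p⟫_ℂ).re + (E - r) * (s - E) * ‖u‖ ^ 2 ≤ ‖p‖ ^ 2) :
    ‖u‖ ≤ 8 * η⁻¹ * ‖h‖ := by
  have hrs : r < s := hE.1.trans hE.2
  have hη0 : 0 < η := by rw [hη]; exact lt_min (sub_pos.2 hE.1) (sub_pos.2 hE.2)
  have hηa : η ≤ E - r := hη ▸ min_le_left _ _
  have hηb : η ≤ s - E := hη ▸ min_le_right _ _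
  set q : ℝ := √(η * (s - r)) with hq
  have hq0 : 0 ≤ q := Real.sqrt_nonneg _
  have hq2 : q ^ 2 = η * (s - r) := Real.sq_sqrt (mul_nonneg hη0.le (sub_nonneg.2 hrs.le))
  have hηq : η ≤ q := Real.le_sqrt_of_sq_le <| by
    rw [sq]
    exact mul_le_mul_of_nonneg_left (by linarith) hη0.le
  set c := combesThomasRate qm R with hc
  have hc0 : 0 < c := combesThomasRate_pos qm R
  set P : ℝ := √(2 * R + |qm|) with hP
  have hP0 : 0 ≤ P := Real.sqrt_nonneg _
  have hP2 : P ^ 2 = 2 * R + |qm| := Real.sq_sqrt (by positivity)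
  have hcc : c * (8 * √R + 16 * P + 24) = 1 := inv_mul_cancel₀ (by positivity)
  have hsR := Real.sqrt_nonneg R
  have hc1 : c * (8 * √R) ≤ 1 := by linarith [mul_nonneg hc0.le hP0]
  have hc2 : c * (4 * P + 6) ≤ 1 / 4 := by linarith [mul_nonneg hc0.le hsR]
  have hc3 : 64 * (c ^ 2 * R) ≤ 1 := by
    have : (c * (8 * √R)) ^ 2 ≤ 1 := pow_le_one₀ (by positivity) hc1
    rw [mul_pow, mul_pow, Real.sq_sqrt hR.le] at this
    linarith
  have hε0 : 0 ≤ ε := hε ▸ mul_nonneg hc0.le hq0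
  have hε2 : 4 * ε ^ 2 ≤ η / 8 := by
    have h1 : ε ^ 2 = c ^ 2 * (η * (s - r)) := by rw [hε, mul_pow, hq2]
    have h2 : c ^ 2 * (η * (s - r)) ≤ c ^ 2 * (η * (2 * R)) := by
      gcongr
      linarith
    linarith [mul_le_mul_of_nonneg_left hc3 hη0.le]
  set N := ‖u‖
  have hN0 : 0 ≤ N := norm_nonneg u
  by_contra! hlt
  have hhN : ‖h‖ ≤ η / 8 * N := by
    rw [mul_right_comm, ← div_eq_mul_inv, div_lt_iff₀ hη0] at hlt
    linarith
  have hN : 0 < N := lt_of_le_of_lt (by positivity) hlt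
  have hlN : ‖l‖ ≤ 4 * N := hl
  have hεl : ε ^ 2 * ‖l‖ ≤ η / 8 * N := by
    linarith [mul_le_mul_of_nonneg_left hlN (sq_nonneg ε), mul_le_mul_of_nonneg_right hε2 hN0]
  have hre : |(⟪u, p⟫_ℂ).re| ≤ η / 4 * N ^ 2 := by
    have e1 : (⟪u, p⟫_ℂ).re = (⟪u, h⟫_ℂ).re + ε ^ 2 * (⟪u, l⟫_ℂ).re := by
      rw [hp, inner_add_right, inner_sub_right, inner_smul_right, inner_smul_right, Complex.add_re,
        Complex.sub_re, Complex.re_ofReal_mul, Complex.re_ofReal_mul, hk0]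
      ring
    have e2 : |(⟪u, h⟫_ℂ).re| ≤ N * ‖h‖ := (Complex.abs_re_le_norm _).trans (norm_inner_le_norm _ _)
    have e3 : |(⟪u, l⟫_ℂ).re| ≤ N * ‖l‖ := (Complex.abs_re_le_norm _).trans (norm_inner_le_norm _ _)
    rw [e1]
    refine (abs_add_le _ _).trans ?_
    rw [abs_mul, abs_of_nonneg (sq_nonneg ε)]
    linarith [mul_le_mul_of_nonneg_left e3 (sq_nonneg ε), mul_le_mul_of_nonneg_left hhN hN0,
      mul_le_mul_of_nonneg_left hεl hN0]
  have hu'N : ‖u'‖ ≤ P * N := by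
    refine abs_le_of_sq_le_sq' ?_ (by positivity) |>.2
    rw [mul_pow, hP2]
    have e3 := (abs_le.1 hre).2
    have e4 : -qm ≤ |qm| := neg_le_abs qm
    have e5 : η / 4 + E - qm ≤ 2 * R + |qm| := by linarith [hE.2]
    linarith [mul_le_mul_of_nonneg_right e5 (sq_nonneg N)]
  have hpN : ‖p‖ ≤ q / 2 * N := by
    have e1 : ‖k‖ ≤ (4 * P + 6) * N := by linarith
    have e2 : ‖p‖ ≤ ‖h‖ + ε * ‖k‖ + ε ^ 2 * ‖l‖ := by
      rw [hp]
      refine (norm_add_le _ _).trans (add_le_add ((norm_sub_le _ _).trans ?_) ?_)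
      · rw [norm_smul, Complex.norm_real, Real.norm_of_nonneg hε0]
      · rw [norm_smul, Complex.norm_real, Real.norm_of_nonneg (sq_nonneg ε)]
    have e3 : ε * ‖k‖ ≤ q / 4 * N := by
      calc ε * ‖k‖ ≤ ε * ((4 * P + 6) * N) := by gcongr
        _ = c * (4 * P + 6) * (q * N) := by rw [hε]; ring
        _ ≤ 1 / 4 * (q * N) := by gcongr
        _ = q / 4 * N := by ring
    linarith [mul_le_mul_of_nonneg_right hηq hN0]
  have hp2 : ‖p‖ ^ 2 ≤ η * (s - r) / 4 * N ^ 2 := by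
    calc ‖p‖ ^ 2 ≤ (q / 2 * N) ^ 2 := by gcongr
      _ = η * (s - r) / 4 * N ^ 2 := by rw [mul_pow, div_pow, hq2]; ring
  -- With `m = max (E - r) (s - E)`, so that `(E - r) (s - E) = η m` and `2 m ≥ s - r`, the left
  -- side of the gap inequality is at least `η m (1 - 1 / 4) ‖u‖²`.
  have hlow : η * (s - r) * (3 / 8) * N ^ 2 ≤
      ((s - E) - (E - r)) * (⟪u, p⟫_ℂ).re + (E - r) * (s - E) * N ^ 2 := by
    obtain ⟨hx1, hx2⟩ := abs_le.1 hre
    have hηN : 0 ≤ η * N ^ 2 := by positivity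
    rcases le_total (E - r) (s - E) with hab | hab
    · have hη' : E - r = η := by rw [hη, min_eq_left hab]
      have m1 := mul_le_mul_of_nonneg_left hx1 (sub_nonneg.2 hab)
      rw [hη'] at m1 hab ⊢
      have : s - r = η + (s - E) := by linarith
      rw [this]
      linarith [mul_nonneg hηN (sub_nonneg.2 hab), mul_nonneg hηN hη0.le]
    · have hη' : s - E = η := by rw [hη, min_eq_right hab]
      have m1 := mul_le_mul_of_nonneg_left hx2 (sub_nonneg.2 hab)
      rw [hη'] at m1 hab ⊢
      have : s - r = η + (E - r) := by linarith
      rw [this]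
      linarith [mul_nonneg hηN (sub_nonneg.2 hab), mul_nonneg hηN hη0.le]
  have hfin : 0 < η * (s - r) * N ^ 2 :=
    mul_pos (mul_pos hη0 (sub_pos.2 hrs)) (by positivity)
  linarith

section

variable {d : ℕ} {S : Set (Edge d)} {D : ℝ}

lemma mem_hamiltonianGraph_of_domain {qm qp : ℝ} {ω : Config d qm qp}
    (u : (hamiltonian ω S).domain) :
    ((u : GraphL2 S), hamiltonian ω S u) ∈ hamiltonianGraph ω S := by
  rw [← hamiltonian_graph]
  exact (hamiltonian ω S).mem_graph u

/-- The gap inequality for the Schrödinger operator. -/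
lemma hamiltonian_gap_inequality {qm qp : ℝ} {ω : Config d qm qp} {r s : ℝ} (hrs : r < s)
    (hres : ∀ t ∈ Ioo r s, (t : ℂ) ∈ resolventSet (hamiltonian ω S)) {E : ℝ} {u p : GraphL2 S}
    (hu : (u, p + (E : ℂ) • u) ∈ hamiltonianGraph ω S) :
    ((s - E) - (E - r)) * (⟪u, p⟫_ℂ).re + (E - r) * (s - E) * ‖u‖ ^ 2 ≤ ‖p‖ ^ 2 := by
  rw [← hamiltonian_graph, LinearPMap.mem_graph_iff] at hu
  obtain ⟨y, hy, hyp⟩ := hu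
  simp only at hy hyp
  have h := gap_inequality (T := hamiltonian ω S) (fun u v => hamiltonianGraph_symmetric
    (mem_hamiltonianGraph_of_domain u) (mem_hamiltonianGraph_of_domain v)) hrs hres E y
  rwa [hyp, hy, add_sub_cancel_right] at h

/-- If `(H - E) g = h` and the weight `w` vanishes on the support of `h`, then
`‖exp (ε w) g‖ ≤ 8 η⁻¹ ‖h‖` for `ε` equal to a small multiple of `√(η (s - r))`. -/
lemma norm_exp_mul_le (φ : VertexWeight S D) {qm qp R r s E η ε : ℝ} {ω : Config d qm qp}
    (hR : 0 < R) (hr : -R ≤ r) (hs : s ≤ R)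
    (hres : ∀ t ∈ Ioo r s, (t : ℂ) ∈ resolventSet (hamiltonian ω S))
    (hE : E ∈ Ioo r s) (hη : η = min (E - r) (s - E))
    (hε : ε = combesThomasRate qm R * √(η * (s - r))) {g h : GraphL2 S}
    (hg : (g, h + (E : ℂ) • g) ∈ hamiltonianGraph ω S) (hh : graphMul (φ.exp ε) h = h) :
    ‖graphMul (φ.exp ε) g‖ ≤ 8 * η⁻¹ * ‖h‖ := by
  obtain ⟨u', hu', hu⟩ := φ.conjugated_equation ε hg hh
  have hgap := hamiltonian_gap_inequality (hE.1.trans hE.2) hres hu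
  have hen := norm_deriv_sq_le hu hu'
  generalize graphMul (φ.exp ε) g = u at *
  refine norm_le_of_gap_inequality (u' := u') hR hr hs hE hη hε rfl
    (φ.re_inner_first_order hu') ?_ ?_ ?_ hgap
  · refine (norm_add_le _ _).trans ?_
    rw [norm_smul, Complex.norm_ofNat]
    have h1 := φ.norm_deriv₁_le u'
    have h2 := φ.norm_deriv₂_le u
    linarith
  · have h1 := φ.norm_deriv₁_le (graphMul φ.deriv₁ u)
    have h2 := φ.norm_deriv₁_le u
    linarith
  · have h3 : (⟪u, u⟫_ℂ).re = ‖u‖ ^ 2 := inner_self_eq_norm_sq (𝕜 := ℂ) u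
    rw [inner_add_right, inner_smul_right, Complex.add_re, Complex.re_ofReal_mul, h3] at hen
    linarith

end

/-! ### The distance function on the lattice -/

/-- The point of `ℝ^d` at a vertex. -/
def vertexPoint {d : ℕ} (v : Fin d → ℤ) : EuclideanSpace ℝ (Fin d) :=
  WithLp.toLp 2 (fun i => (v i : ℝ))

lemma Edge.point_eq {d : ℕ} (e : Edge d) (t : ℝ) :
    e.point t = vertexPoint e.base + t • EuclideanSpace.single e.dir (1 : ℝ) := by
  ext i
  simp [Edge.point, vertexPoint]

lemma Edge.point_zero {d : ℕ} (e : Edge d) : e.point 0 = vertexPoint e.init := by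
  rw [e.point_eq, zero_smul, add_zero, Edge.init]

lemma Edge.point_one {d : ℕ} (e : Edge d) : e.point 1 = vertexPoint e.term := by
  ext i
  by_cases h : i = e.dir <;> simp [Edge.point, vertexPoint, Edge.term, h]

lemma Edge.continuous_point {d : ℕ} (e : Edge d) : Continuous e.point := by
  simp_rw [funext e.point_eq]
  fun_prop

lemma Edge.dist_vertexPoint {d : ℕ} (e : Edge d) :
    dist (vertexPoint e.term) (vertexPoint e.init) = 1 := by
  rw [← e.point_zero, ← e.point_one, e.point_eq, e.point_eq]
  simp

/-- The endpoints of an edge whose interior lies in `U` belong to the closure of `U`. -/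
lemma vertexPoint_mem_closure {d : ℕ} {U : Set (EuclideanSpace ℝ (Fin d))} {e : Edge d}
    (he : e ∈ edgesIn U) : vertexPoint e.init ∈ closure U ∧ vertexPoint e.term ∈ closure U := by
  have h : ∀ t ∈ Icc (0 : ℝ) 1, e.point t ∈ closure U := fun t ht => by
    rw [← closure_Ioo zero_ne_one] at ht
    exact closure_mono he (image_closure_subset_closure_image e.continuous_point ⟨t, ht, rfl⟩)
  exact ⟨e.point_zero ▸ h 0 (by simp), e.point_one ▸ h 1 (by simp)⟩

/-- The distance from `B`, truncated at `D`, on the vertices. -/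
def distWeight {d : ℕ} (S : Set (Edge d)) (B : Set (EuclideanSpace ℝ (Fin d))) {D : ℝ}
    (hD : 0 ≤ D) : VertexWeight S D where
  val v := min (Metric.infDist (vertexPoint v) B) D
  mem_Icc v := ⟨le_min Metric.infDist_nonneg hD, min_le_right _ _⟩
  lip e _ := by
    refine (abs_min_sub_min_le_max _ _ _ _).trans ?_
    rw [sub_self, abs_zero, max_eq_left (abs_nonneg _), ← e.dist_vertexPoint, ← Real.dist_eq]
    exact (Metric.lipschitz_infDist_pt B).dist_le_mul _ _ |>.trans (by simp)

section

variable {d : ℕ} {S : Set (Edge d)} {A B : Set (EuclideanSpace ℝ (Fin d))} {D : ℝ}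

lemma distWeight_eq_zero (hD : 0 ≤ D) {v : Fin d → ℤ} (hv : vertexPoint v ∈ closure B) :
    (distWeight S B hD).val v = 0 := by
  change min (Metric.infDist (vertexPoint v) B) D = 0
  rw [Metric.infDist_zero_of_mem_closure hv, min_eq_left hD]

lemma distWeight_eq_of_mem_closure (hD : 0 ≤ D) (hB : B.Nonempty) (hAB : D ≤ setDist A B)
    {v : Fin d → ℤ} (hv : vertexPoint v ∈ closure A) : (distWeight S B hD).val v = D := by
  refine min_eq_right ?_
  have hcl : IsClosed {x | D ≤ Metric.infDist x B} :=
    isClosed_le continuous_const (Metric.continuous_infDist_pt B)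
  refine closure_minimal (fun a ha => ?_) hcl hv
  refine (Metric.le_infDist hB).2 fun b hb => hAB.trans (csInf_le ⟨0, ?_⟩ ⟨a, ha, b, hb, rfl⟩)
  rintro _ ⟨x, -, y, -, rfl⟩
  exact dist_nonneg

/-- On an edge whose end values agree, `exp (ε w)` is constant. -/
lemma graphMul_exp_apply_of_eq (φ : VertexWeight S D) (ε : ℝ) {e : S} {x : ℝ}
    (h0 : φ.val e.1.init = x) (h1 : φ.val e.1.term = x) (f : GraphL2 S) :
    graphMul (φ.exp ε) f e = ((Real.exp (ε * x) : ℝ) : ℂ) • f e := by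
  rw [graphMul_apply, ← edgeMul_const]
  congr 2
  refine ContinuousMap.ext fun t => ?_
  simp [VertexWeight.exp, interp, h0, h1]

end

lemma infDist_compl_Ioo {r s E : ℝ} (hE : E ∈ Ioo r s) :
    Metric.infDist E (Ioo r s)ᶜ = min (E - r) (s - E) := by
  have hr : r ∈ (Ioo r s)ᶜ := by simp
  have hs : s ∈ (Ioo r s)ᶜ := by simp
  refine le_antisymm (le_min ?_ ?_) ((Metric.le_infDist ⟨r, hr⟩).2 fun y hy => ?_)
  · simpa [Real.dist_eq, abs_of_pos (sub_pos.2 hE.1)] using Metric.infDist_le_dist_of_mem (x := E) hr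
  · simpa [Real.dist_eq, abs_sub_comm, abs_of_pos (sub_pos.2 hE.2)] using
      Metric.infDist_le_dist_of_mem (x := E) hs
  · rw [Real.dist_eq]
    by_cases h : r < y
    · have : s ≤ y := not_lt.1 fun h' => hy ⟨h, h'⟩
      exact (min_le_right _ _).trans ((by linarith : s - E ≤ -(E - y)).trans (neg_le_abs _))
    · exact (min_le_left _ _).trans ((by linarith : E - r ≤ E - y).trans (le_abs_self _))

lemma norm_cutoff_le {d : ℕ} {S : Set (Edge d)} (S' : Set (Edge d)) (f : GraphL2 S) :
    ‖cutoff S' f‖ ≤ ‖f‖ := by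
  have h : ‖(cutoff S' : GraphL2 S →L[ℂ] GraphL2 S)‖ ≤ 1 :=
    LinearMap.mkContinuous_norm_le _ zero_le_one _
  simpa using (cutoff S').le_of_opNorm_le h f

open Classical in
lemma cutoff_apply {d : ℕ} {S : Set (Edge d)} (S' : Set (Edge d)) (f : GraphL2 S) (e : S) :
    cutoff S' f e = if (e : Edge d) ∈ S' then f e else 0 := rfl

/-! ### The Combes–Thomas estimate -/

/-- The Combes–Thomas estimate for an arbitrary edge set `S`, applied to a vector `f`, with any
`D ≤ dist (A, B)` in place of the distance. -/
lemma norm_cutoff_resolvent_le {d : ℕ} {S : Set (Edge d)} {A B : Set (EuclideanSpace ℝ (Fin d))}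
    {qm qp R r s E η ε D : ℝ} {ω : Config d qm qp} (hR : 0 < R) (hr : -R ≤ r) (hs : s ≤ R)
    (hres : ∀ t ∈ Ioo r s, (t : ℂ) ∈ resolventSet (hamiltonian ω S))
    (hE : E ∈ Ioo r s) (hη : η = min (E - r) (s - E))
    (hε : ε = combesThomasRate qm R * √(η * (s - r))) (hD : 0 ≤ D) (hB : B.Nonempty)
    (hAB : D ≤ setDist A B) (f : GraphL2 S) :
    ‖cutoff (edgesIn A) (resolvent (hamiltonian ω S) E (cutoff (edgesIn B) f))‖ ≤
      8 * η⁻¹ * Real.exp (-(ε * D)) * ‖f‖ := by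
  have hη0 : 0 < η := by rw [hη]; exact lt_min (sub_pos.2 hE.1) (sub_pos.2 hE.2)
  set h : GraphL2 S := cutoff (edgesIn B) f with hh
  obtain ⟨y, hy, hyh⟩ := (isResolvent_resolvent (hres E hE)).2 h
  rw [← hy]
  set g : GraphL2 S := (y : GraphL2 S)
  have hg : (g, h + (E : ℂ) • g) ∈ hamiltonianGraph ω S := by
    rw [← hyh, sub_add_cancel]
    exact mem_hamiltonianGraph_of_domain y
  set φ := distWeight S B hD
  -- The weight vanishes on the edges of `B`.
  have hφh : graphMul (φ.exp ε) h = h := by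
    refine lp.ext (funext fun e => ?_)
    by_cases he : (e : Edge d) ∈ edgesIn B
    · have hcl := vertexPoint_mem_closure he
      rw [graphMul_exp_apply_of_eq φ ε (distWeight_eq_zero hD hcl.1)
        (distWeight_eq_zero hD hcl.2), mul_zero, Real.exp_zero, Complex.ofReal_one, one_smul]
    · rw [graphMul_apply, hh, cutoff_apply, if_neg he, map_zero]
  have hu := norm_exp_mul_le φ hR hr hs hres hE hη hε hg hφh
  -- The weight equals `D` on the edges of `A`.
  have hA : cutoff (edgesIn A) (graphMul (φ.exp ε) g) =
      ((Real.exp (ε * D) : ℝ) : ℂ) • cutoff (edgesIn A) g := by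
    refine lp.ext (funext fun e => ?_)
    rw [lp.coeFn_smul, Pi.smul_apply, cutoff_apply, cutoff_apply]
    by_cases he : (e : Edge d) ∈ edgesIn A
    · have hcl := vertexPoint_mem_closure he
      rw [if_pos he, if_pos he, graphMul_exp_apply_of_eq φ ε
        (distWeight_eq_of_mem_closure hD hB hAB hcl.1)
        (distWeight_eq_of_mem_closure hD hB hAB hcl.2)]
    · rw [if_neg he, if_neg he, smul_zero]
  have hA' := norm_cutoff_le (edgesIn A) (graphMul (φ.exp ε) g)
  rw [hA, norm_smul, Complex.norm_real, Real.norm_of_nonneg (Real.exp_pos _).le] at hA'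
  have hf : ‖h‖ ≤ ‖f‖ := norm_cutoff_le _ _
  rw [Real.exp_neg, mul_right_comm, ← div_eq_mul_inv, le_div_iff₀ (Real.exp_pos _), mul_comm]
  exact hA'.trans (hu.trans (by gcongr))

end QuantumGraph

end

theorem mainTheorem4 (qm qp R : ℝ) (hR : 0 < R) :
    ∃ c₁ c₂ : ℝ, 0 < c₁ ∧ 0 < c₂ ∧
      ∀ (d : ℕ) (ω : QuantumGraph.Config d qm qp)
        (Λ A B : Set (EuclideanSpace ℝ (Fin d))) (δ r s E η : ℝ),
        QuantumGraph.IsBox Λ → QuantumGraph.IsEdgeBounded Λ →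
        QuantumGraph.IsEdgeBounded A → A ⊆ Λ →
        QuantumGraph.IsEdgeBounded B → B ⊆ Λ →
        δ = QuantumGraph.setDist A B → 1 ≤ δ →
        (∀ t ∈ Set.Ioo r s, (t : ℂ) ∈ QuantumGraph.resolventSet
          (QuantumGraph.hamiltonian ω (QuantumGraph.edgesIn Λ))) →
        Set.Ioo r s ⊆ Set.Ioo (-R) R →
        E ∈ Set.Ioo r s → η = Metric.infDist E (Set.Ioo r s)ᶜ →
        ‖(QuantumGraph.cutoff (QuantumGraph.edgesIn A)).comp
            ((QuantumGraph.resolvent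
                (QuantumGraph.hamiltonian ω (QuantumGraph.edgesIn Λ)) (E : ℂ)).comp
              (QuantumGraph.cutoff (QuantumGraph.edgesIn B)))‖
          ≤ c₁ * η⁻¹ * Real.exp (-c₂ * Real.sqrt (η * (s - r)) * δ) := by
  refine ⟨8, QuantumGraph.combesThomasRate qm R, by norm_num,
    QuantumGraph.combesThomasRate_pos qm R, ?_⟩
  intro d ω Λ A B δ r s E η _ _ _ _ hB _ hδ hδ1 hres hsub hE hη
  rw [QuantumGraph.infDist_compl_Ioo hE] at hη
  obtain ⟨hr, hs⟩ := (Set.Ioo_subset_Ioo_iff (hE.1.trans hE.2)).1 hsub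
  have hη0 : 0 < η := by rw [hη]; exact lt_min (sub_pos.2 hE.1) (sub_pos.2 hE.2)
  refine ContinuousLinearMap.opNorm_le_bound _ (by positivity) fun f => ?_
  simp only [ContinuousLinearMap.comp_apply]
  have hw := QuantumGraph.norm_cutoff_resolvent_le (A := A) hR hr hs hres hE hη rfl
    (zero_le_one.trans hδ1) hB.isConnected.nonempty hδ.le f
  refine hw.trans (le_of_eq ?_)
  rw [neg_mul, neg_mul]
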